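/- **Setting.** Let $\Omega=\{x_1<\dots<x_n\}$ and $A_i=\{x_1,\dots,x_i\}$ ($A_0=\emptyset$). A distribution function is an increasing $F$ with $F(x_n)=1$; we set $F(x_0)=0$, write $F(k)$ for $F(x_k)$, and $P_F(h)=\sum_k h(x_k)(F(k)-F(k-1))$. A $p$-box is a pair of distribution functions $\underline F\le\overline F$; $\mathcal M$ is the set of distribution functions $F$ with $\underline F\le F\le\overline F$. The constraint sets are $A_i$ ($1\le i\le n$), $A_i^c$ ($1\le i<n$), $\{x_i\}$ ($1\le i\le n$), with constraints $P(A_i)\ge\underline F(i)$, $P(A_i^c)\ge 1-\overline F(i)$, $P(\{x_i\})\ge 0$. (Since $\{x_1\}=A_1$ and $\{x_n\}=A_{n-1}^c$, these two sets carry the bound of $A_1$ resp. $A_{n-1}^c$.) For a family $\mathcal B$ of sets let $\mathrm{cone}(\mathcal B)$ be the set of all nonnegative combinations of $1_G$, $G\in\mathcal B\setminus\{\Omega\}$, plus real multiples of $1_\Omega$. A family $\mathcal B$ of constraint sets is (the generator set of) a MESC if $\Omega\in\mathcal B$, the vectors $1_G$ ($G\in\mathcal B$) form a basis of $\mathbb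 R^\Omega$, and no $1_G$, with $G\notin\mathcal B$ a constraint set, is a nonnegative combination of them. Two MESCs are adjacent if their cones intersect in a common face of codimension $1$. Given a $p$-box, $F$ is the extreme distribution of $\mathcal B$ if $F$ is an extreme point of $\mathcal M$, the constraints of all $G\in\mathcal B$ hold with equality at $P_F$, and $\mathrm{cone}(\mathcal B)$ lies in the normal cone $\{h: P_F(h)\le P_H(h)\ \forall H\in\mathcal M\}$; $\mathcal B$ is then called feasible. Fix a MESC $\mathcal B$. Its chain consists of those $A_k$ with $A_k\in\mathcal B$ ("$k$ is $+$") or $A_k^c\in\mathcal B$, $1\le k<n$ ("$k$ is $-$"), together with $A_0$, counted as $+$. Its singletons are the $\{x_i\}\in\mathcal B$ with $1<i<n$. A pair $(a,b)$ or triple $(a,b,c)$ denotes indices $a<b(<c)$ of consecutive chain members. An index $j$ is missing in $(a,b)$ if $a<j\le b$ and $\{x_j\}$ is not a singleton of $\mathcal B$. We write $F'=F[s,t;v]$ for the function equal to $v$ at $s\le k\le t$ and to $F(k)$ elsewhere. **Theorem.** Every MESC adjacent to $\mathcal B$ arises by replacing exactly one $G\in\mathcal B\setminus\{\Omega\}$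 by one $G'\notin\mathcal B$, and $G$ is either a singleton $\{x_i\}$ with $a<i\le b$ for a pair $(a,b)$, or the middle member ($A_b$ or $A_b^c$) of a triple $(a,b,c)$. Every pair $(a,b)$ has exactly one missing index; it is $a+1$ for signs $(+,+)$ and $b$ for $(-,-)$, and for $(+,-)$ one has $b=a+1$. The sets $G'$ whose substitution for $G$ gives an adjacent MESC are exactly those listed below. Moreover, for every $p$-box for which $\mathcal B$ has an extreme distribution $F$, the new family has an extreme distribution $F'$ if and only if the stated inequality holds (always, if none is stated), and then $F'$ is as stated. Formulas for $F$ hold for $a\le k\le b$ (pairs) or $a\le k\le c$ (triples). *Excluding a singleton $\{x_i\}$, $a<i\le b$:* - **1A** $(+,+)$: only $G'=A_{i-1}$; $F'=F[a+1,i-1;\underline F(i-1)]\le F$. - **2A** $(+,-)$: there is no singleton to exclude. - **3A** $(-,+)$, $j$ missing. Here $F(k)=\overline F(a)$ for $k\le j-1$ and $F(k)=\underline F(b)$ for $k\ge j$. - $i<j$: $G'=\{x_j\}$, only if $b<n$, feasible iff $\underline F(b)\le\overline F(i)$, $F'=F[i,j-1;\underline F(b)]\ge F$; or $G'=A_i^c$,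 feasible iff $\underline F(b)\ge\overline F(i)$, $F'=F[i,j-1;\overline F(i)]\ge F$. - $i>j$: $G'=\{x_j\}$, feasible iff $\underline F(i-1)\le\overline F(a)$, $F'=F[j,i-1;\overline F(a)]\le F$; or $G'=A_{i-1}$, feasible iff $\underline F(i-1)\ge\overline F(a)$, $F'=F[j,i-1;\underline F(i-1)]\le F$. - **4A** $(-,-)$: only $G'=A_i^c$; $F'=F[i,b-1;\overline F(i)]\ge F$. *Excluding $A_b$ or $A_b^c$ from a triple $(a,b,c)$:* - **1B** $(+,+,+)$: $F(a)=\underline F(a)$, $F=\underline F(b)$ on $a<k\le b$, $F=\underline F(c)$ on $b<k\le c$. $G'=\{x_{b+1}\}$, only if $c<n$, feasible iff $\underline F(c)\le\overline F(a+1)$, $F'=F[a+1,b;\underline F(c)]\ge F$; or $G'=A_{a+1}^c$, feasible iff $\underline F(c)\ge\overline F(a+1)$, $F'=F[a+1,b;\overline F(a+1)]\ge F$. - **1B, second variant** $(+,-,+)$, $j$ missing in $(b,c)$: $F(a)=\underline F(a)$, $F=\overline F(a+1)$ on $a<k\le j-1$, $F=\underline F(c)$ on $j\le k\le c$. Only $G'=A_{j-1}$;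 $F'=F[a+1,j-1;\underline F(j-1)]\le F$. - **2B** $(+,+,-)$: $c=b+1$; $F(a)=\underline F(a)$, $F=\underline F(b)$ on $a<k\le b$, $F(c)=\overline F(c)$. Only $G'=A_{a+1}^c$; $F'=F[a+1,b;\overline F(a+1)]\ge F$. - **2B, second variant** $(+,-,-)$: $b=a+1$; $F(a)=\underline F(a)$, $F=\overline F(a+1)$ on $a<k\le c-1$, $F(c)=\overline F(c)$. Only $G'=A_{c-1}$; $F'=F[a+1,c-1;\underline F(c-1)]\le F$. - **3B** $(-,+,+)$, $j$ missing in $(a,b)$: $F=\overline F(a)$ on $a\le k\le j-1$, $\underline F(b)$ on $j\le k\le b$, $\underline F(c)$ on $b<k\le c$. $G'=\{x_{b+1}\}$, only if $c<n$, feasible iff $\underline F(c)\le\overline F(j)$, $F'=F[j,b;\underline F(c)]\ge F$; or $G'=A_j^c$, feasible iff $\underline F(c)\ge\overline F(j)$, $F'=F[j,b;\overline F(j)]\ge F$. - **3B, second variant** $(-,-,+)$, $j$ missing in $(b,c)$: $F=\overline F(a)$ on $a\le k\le b-1$, $\overline F(b)$ on $b\le k\le j-1$, $\underline F(c)$ on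 $j\le k\le c$. $G'=A_{j-1}$, feasible iff $\underline F(j-1)\ge\overline F(a)$, $F'=F[b,j-1;\underline F(j-1)]\le F$; or $G'=\{x_b\}$, feasible iff $\underline F(j-1)\le\overline F(a)$, $F'=F[b,j-1;\overline F(a)]\le F$. - **4B** $(-,+,-)$, $j$ missing in $(a,b)$: $c=b+1$; $F=\overline F(a)$ on $a\le k\le j-1$, $\underline F(b)$ on $j\le k\le b$, $F(c)=\overline F(c)$. Only $G'=A_j^c$; $F'=F[j,b;\overline F(j)]\ge F$. - **4B, second variant** $(-,-,-)$: $F=\overline F(a)$ on $a\le k\le b-1$, $\overline F(b)$ on $b\le k\le c-1$, $F(c)=\overline F(c)$. $G'=A_{c-1}$, feasible iff $\underline F(c-1)\ge\overline F(a)$, $F'=F[b,c-1;\underline F(c-1)]\le F$; or $G'=\{x_b\}$, feasible iff $\underline F(c-1)\le\overline F(a)$, $F'=F[b,c-1;\overline F(a)]\le F$. -/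

import Mathlib

/-! The finite sample space is `Fin n`; its element `k` plays the role of `x_{k+1}`, so that
`x_1 < ⋯ < x_n`. A distribution function is recorded as `F : ℕ → ℝ` with `F k = P(X ≤ x_k)`,
`F 0 = 0`, and `F k = 1` for `k ≥ n`. -/

namespace PBox

noncomputable section

/-- The set `A_i = {x_1, …, x_i}`. -/
def seg (n i : ℕ) : Finset (Fin n) := Finset.univ.filter fun k => k.val < i

/-- The singleton `{x_i}`, for `1 ≤ i ≤ n`. -/
def pt (n i : ℕ) : Finset (Fin n) := Finset.univ.filter fun k => k.val + 1 = i

/-- The indicator function of a set. -/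
def ind {n : ℕ} (G : Finset (Fin n)) : Fin n → ℝ := fun k => if k ∈ G then 1 else 0

/-- The sets whose probabilities are bounded below by a `p`-box:
`A_i` for `1 ≤ i ≤ n`, `A_iᶜ` for `1 ≤ i < n`, and `{x_i}` for `1 ≤ i ≤ n`. -/
def IsConstraintSet {n : ℕ} (G : Finset (Fin n)) : Prop :=
  (∃ i, 1 ≤ i ∧ i ≤ n ∧ G = seg n i) ∨
  (∃ i, 1 ≤ i ∧ i < n ∧ G = (seg n i)ᶜ) ∨
  (∃ i, 1 ≤ i ∧ i ≤ n ∧ G = pt n i)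

/-- All nonnegative combinations of the indicators of the sets in `B`. -/
def nonnegCone {n : ℕ} (B : Finset (Finset (Fin n))) : Set (Fin n → ℝ) :=
  {h | ∃ α : Finset (Fin n) → ℝ, (∀ G ∈ B, 0 ≤ α G) ∧ h = ∑ G ∈ B, α G • ind G}

/-- The cone of a family of sets: nonnegative combinations of the indicators of the members
other than the whole space, plus an arbitrary real multiple of the constant `1`. -/
def cone {n : ℕ} (B : Finset (Finset (Fin n))) : Set (Fin n → ℝ) :=
  {h | ∃ (α : Finset (Fin n) → ℝ) (β : ℝ), (∀ G ∈ B.erase Finset.univ, 0 ≤ α G) ∧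
    h = (∑ G ∈ B.erase Finset.univ, α G • ind G) + β • ind Finset.univ}

/-- `B` is the generator family of a maximal elementary simplicial cone of `p`-boxes on `n`
points: it contains the whole space, the indicators of its members form a basis of `ℝⁿ`, and no
further constraint set has its indicator among their nonnegative combinations. -/
structure IsMESC {n : ℕ} (B : Finset (Finset (Fin n))) : Prop where
  isConstraintSet : ∀ G ∈ B, IsConstraintSet G
  univ_mem : Finset.univ ∈ B
  linearIndep : LinearIndepOn ℝ ind (B : Set (Finset (Fin n)))
  card_eq : B.card = n
  elementary : ∀ G, IsConstraintSet G → G ∉ B → ind G ∉ nonnegCone B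

/-- Two cones are adjacent if they intersect in a common face of codimension one. -/
def ConesAdjacent {n : ℕ} (C D : Set (Fin n → ℝ)) : Prop :=
  IsExposed ℝ C (C ∩ D) ∧ IsExposed ℝ D (C ∩ D) ∧
    Module.finrank ℝ (Submodule.span ℝ (C ∩ D)) + 1 = n

/-- The family obtained from `B` when `G` is replaced by `G'`. -/
def swap {n : ℕ} (B : Finset (Finset (Fin n))) (G G' : Finset (Fin n)) :
    Finset (Finset (Fin n)) := insert G' (B.erase G)

/-- Replacing the generator `G` of `B` by the new set `G'` gives a maximal elementary simplicial
cone adjacent to that of `B`. -/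
def AdjacentSwap {n : ℕ} (B : Finset (Finset (Fin n))) (G G' : Finset (Fin n)) : Prop :=
  G ∈ B ∧ G ≠ Finset.univ ∧ G' ∉ B ∧ IsMESC (swap B G G') ∧
    ConesAdjacent (cone B) (cone (swap B G G'))

/-! ### Distribution functions and `p`-boxes -/

/-- Distribution functions on the `n`-point space. -/
def IsDist (n : ℕ) (F : ℕ → ℝ) : Prop := Monotone F ∧ F 0 = 0 ∧ ∀ k, n ≤ k → F k = 1

/-- `(lo, up)` is a `p`-box on the `n`-point space. -/
def IsPBox (n : ℕ) (lo up : ℕ → ℝ) : Prop := IsDist n lo ∧ IsDist n up ∧ lo ≤ up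

/-- The credal set: all distribution functions between the two bounds. -/
def credalSet (n : ℕ) (lo up : ℕ → ℝ) : Set (ℕ → ℝ) := {F | IsDist n F ∧ lo ≤ F ∧ F ≤ up}

/-- The linear prevision `P_F`. -/
def prevision {n : ℕ} (F : ℕ → ℝ) (h : Fin n → ℝ) : ℝ :=
  ∑ k : Fin n, h k * (F (k.val + 1) - F k.val)

/-- The normal cone of `M` at `F`. -/
def normalCone {n : ℕ} (M : Set (ℕ → ℝ)) (F : ℕ → ℝ) : Set (Fin n → ℝ) :=
  {h | ∀ H ∈ M, prevision F h ≤ prevision H h}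

/-- `F` is the extreme distribution of the `p`-box `(lo, up)` that corresponds to the family `B`:
it is an extreme point of the credal set, its normal cone contains the cone of `B`, and every
generator's constraint holds with equality. The constraints are `P(A_i) ≥ lo i`,
`P(A_iᶜ) ≥ 1 - up i` and `P({x_i}) ≥ 0`; the sets `{x_1} = A_1` and `{x_n} = A_{n-1}ᶜ` carry the
stronger one of their two bounds, which is the first resp. the second of these. -/
structure IsExtremeDist {n : ℕ} (lo up : ℕ → ℝ) (B : Finset (Finset (Fin n)))
    (F : ℕ → ℝ) : Prop where
  extreme : F ∈ (credalSet n lo up).extremePoints ℝ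
  cone_subset : cone B ⊆ normalCone (credalSet n lo up) F
  tight_seg : ∀ i, 1 ≤ i → i ≤ n → seg n i ∈ B → prevision F (ind (seg n i)) = lo i
  tight_compl : ∀ i, 1 ≤ i → i < n → (seg n i)ᶜ ∈ B →
    prevision F (ind (seg n i)ᶜ) = 1 - up i
  tight_pt : ∀ i, 1 < i → i < n → pt n i ∈ B → prevision F (ind (pt n i)) = 0

/-- `F` with its values at the indices `s ≤ k ≤ t` replaced by the constant `v`. -/
def patch (F : ℕ → ℝ) (s t : ℕ) (v : ℝ) : ℕ → ℝ := fun k => if s ≤ k ∧ k ≤ t then v else F k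

/-- `B'` has an extreme distribution `F'` exactly if `cond` holds; it is then `F` with the values
at `s ≤ k ≤ t` replaced by `v`, and `F' ≥ F`. -/
def YieldsAbove {n : ℕ} (lo up : ℕ → ℝ) (B' : Finset (Finset (Fin n))) (F : ℕ → ℝ)
    (cond : Prop) (s t : ℕ) (v : ℝ) : Prop :=
  (∀ F', IsExtremeDist lo up B' F' ↔ cond ∧ F' = patch F s t v) ∧ (cond → F ≤ patch F s t v)

/-- `B'` has an extreme distribution `F'` exactly if `cond` holds; it is then `F` with the values
at `s ≤ k ≤ t` replaced by `v`, and `F' ≤ F`. -/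
def YieldsBelow {n : ℕ} (lo up : ℕ → ℝ) (B' : Finset (Finset (Fin n))) (F : ℕ → ℝ)
    (cond : Prop) (s t : ℕ) (v : ℝ) : Prop :=
  (∀ F', IsExtremeDist lo up B' F' ↔ cond ∧ F' = patch F s t v) ∧ (cond → patch F s t v ≤ F)

/-! ### The chain and the singletons of a generator family -/

/-- `A_k` belongs to `B`; the convention `A_0 = ∅` is added to the chain as such a set. -/
def Pos {n : ℕ} (B : Finset (Finset (Fin n))) (k : ℕ) : Prop := k = 0 ∨ (k ≤ n ∧ seg n k ∈ B)

/-- `A_kᶜ` belongs to `B`, where `1 ≤ k < n`. -/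
def Neg {n : ℕ} (B : Finset (Finset (Fin n))) (k : ℕ) : Prop := 1 ≤ k ∧ k < n ∧ (seg n k)ᶜ ∈ B

/-- `A_a ⊂ A_b` are neighbours in the chain of those `A_k` with `A_k` or `A_kᶜ` in `B`. -/
def Consec {n : ℕ} (B : Finset (Finset (Fin n))) (a b : ℕ) : Prop :=
  (Pos B a ∨ Neg B a) ∧ (Pos B b ∨ Neg B b) ∧ a < b ∧
    ∀ k, a < k → k < b → ¬ (Pos B k ∨ Neg B k)

/-- `{x_i}` is a singleton member of `B`; `{x_1} = A_1` and `{x_n} = A_{n-1}ᶜ` count as members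
of the chain, not as singletons. -/
def Sing {n : ℕ} (B : Finset (Finset (Fin n))) (i : ℕ) : Prop := 1 < i ∧ i < n ∧ pt n i ∈ B

/-- Among `x_{a+1}, …, x_b`, the element `x_j` has no singleton in `B`. -/
def Missing {n : ℕ} (B : Finset (Finset (Fin n))) (a b j : ℕ) : Prop :=
  a < j ∧ j ≤ b ∧ ¬ Sing B j

end

end PBox

namespace PBox

variable {n : ℕ} {B : Finset (Finset (Fin n))}

/-! ### The pairing of functions on `ℕ` with gambles -/

/-! Pair a function `F` on `ℕ` with a gamble by summation by parts: $A_k$ receives $F(k)-F(0)$ and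
$\{x_i\}$ receives $F(i)-F(i-1)$. Every linear functional arises this way (`exists_prevision_eq`),
so the dual basis of a MESC consists of functions on `ℕ`. The point of the proof is that the dual
vector of every excludable generator $G$ is, up to sign, the indicator `bump s t` of an interval of
indices. A bump is $1$ on $A_k$ and $-1$ on $A_k^c$ for $s\le k\le t$, it is $1$ on $\{x_s\}$ and
$-1$ on $\{x_{t+1}\}$, and it vanishes on the constraint sets not covered by these.

Linear independence yields a missing index in each pair, spanning makes it unique, and elementarity
puts it next to a left end of sign $+$ or at a right end of sign $-$. For a singleton the bump
stretches between that point and the missing index of its pair; for a chain member it stretches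
between the missing indices of the two pairs around it. These are the `IsBump` lemmas. The value
$\varepsilon=\pm1$ at $G$ tells whether relaxing the constraint of $G$ moves the distribution up or
down.

The hyperplane of the facet opposite $G$ is the kernel of the bump, and $G'$ has to lie strictly
beyond it (`IsMESC.conesAdjacent_swap_iff`). This leaves few constraint sets, and elementarity
reduces them to $A_s^c$ and $\{x_{t+1}\}$ (up), or $A_t$ and $\{x_s\}$ (down). The first of each two
always works. Whether the singleton works depends on the sign of the chain member at that end of the
bump. That conversely every adjacent MESC is an exchange follows from `IsMESC.mem_of_common_face`:
generators on a common face are shared.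

For a MESC, an extreme distribution is just a member of the credal set at which all generators are
tight (`IsMESC.isExtremeDist_iff`). Keeping all of them but $G$ tight confines the new distribution
to the line through $F$ along the bump, and $F$ is constant on the interval, so one is patching a
constant. Tightness of $G'$ fixes the constant; membership in the credal set is four inequalities,
of which three are automatic, and in the unconditional cases the fourth is as well. -/

theorem mem_seg {i : ℕ} {k : Fin n} : k ∈ seg n i ↔ k.val < i := by simp [seg]

theorem mem_pt {i : ℕ} {k : Fin n} : k ∈ pt n i ↔ k.val + 1 = i := by simp [pt]

theorem seg_self : seg n n = Finset.univ := by ext k; simp [mem_seg]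

theorem pt_one : pt n 1 = seg n 1 := by ext k; simp [mem_seg, mem_pt]

theorem pt_last : pt n n = (seg n (n - 1))ᶜ := by
  ext k; simp only [mem_pt, Finset.mem_compl, mem_seg]; omega

/-- The prevision as a linear functional of the gamble. -/
noncomputable def previsionₗ (n : ℕ) (F : ℕ → ℝ) : (Fin n → ℝ) →ₗ[ℝ] ℝ where
  toFun := prevision F
  map_add' x y := by simp [prevision, add_mul, Finset.sum_add_distrib]
  map_smul' c x := by simp [prevision, Finset.mul_sum, mul_assoc]

@[simp] theorem previsionₗ_apply (F : ℕ → ℝ) (h : Fin n → ℝ) :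
    previsionₗ n F h = prevision F h := rfl

theorem prevision_ind (F : ℕ → ℝ) (G : Finset (Fin n)) :
    prevision F (ind G) = ∑ k ∈ G, (F (k.val + 1) - F k.val) := by
  simp [prevision, ind, ite_mul, Finset.sum_ite_mem]

theorem prevision_univ (F : ℕ → ℝ) :
    prevision F (ind (Finset.univ : Finset (Fin n))) = F n - F 0 := by
  rw [prevision_ind, Fin.sum_univ_eq_sum_range (fun k => F (k + 1) - F k), Finset.sum_range_sub]

theorem prevision_seg (F : ℕ → ℝ) {i : ℕ} (hi : i ≤ n) :
    prevision F (ind (seg n i)) = F i - F 0 := by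
  rw [prevision_ind, seg, Finset.sum_filter,
    Fin.sum_univ_eq_sum_range (fun k => if k < i then F (k + 1) - F k else 0),
    ← Finset.sum_filter]
  have : (Finset.range n).filter (· < i) = Finset.range i := by
    ext k; simp only [Finset.mem_filter, Finset.mem_range]; omega
  rw [this, Finset.sum_range_sub]

theorem prevision_compl (F : ℕ → ℝ) {i : ℕ} (hi : i ≤ n) :
    prevision F (ind (seg n i)ᶜ) = F n - F i := by
  have h := Finset.sum_add_sum_compl (seg n i) fun k : Fin n => F (k.val + 1) - F k.val
  rw [← prevision_ind, ← prevision_ind, ← prevision_ind, prevision_univ,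
    prevision_seg F hi] at h
  linarith

theorem prevision_pt (F : ℕ → ℝ) {i : ℕ} (h1 : 1 ≤ i) (hi : i ≤ n) :
    prevision F (ind (pt n i)) = F i - F (i - 1) := by
  have : pt n i = {⟨i - 1, by omega⟩} := by
    ext k; simp only [mem_pt, Finset.mem_singleton, Fin.ext_iff]; omega
  rw [prevision_ind, this, Finset.sum_singleton]
  simp [Nat.sub_add_cancel h1]

theorem prevision_add_smul (F H : ℕ → ℝ) (c : ℝ) (h : Fin n → ℝ) :
    prevision (F + c • H) h = prevision F h + c * prevision H h := by
  simp only [prevision, Pi.add_apply, Pi.smul_apply, smul_eq_mul, Finset.mul_sum,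
    ← Finset.sum_add_distrib]
  exact Finset.sum_congr rfl fun _ _ => by ring

theorem prevision_sum_smul (F : ℕ → ℝ) (S : Finset (Finset (Fin n))) (c : Finset (Fin n) → ℝ) :
    prevision F (∑ H ∈ S, c H • ind H) = ∑ H ∈ S, c H * prevision F (ind H) := by
  simp only [← previsionₗ_apply, map_sum, map_smul, smul_eq_mul]

/-- Every linear functional is a prevision. -/
theorem exists_prevision_eq (φ : (Fin n → ℝ) →ₗ[ℝ] ℝ) :
    ∃ F : ℕ → ℝ, F 0 = 0 ∧ ∀ h, prevision F h = φ h := by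
  -- The only normalised choice, since $A_k$ must receive $F(k)-F(0)$. It is checked on points,
  -- whose indicators are differences of consecutive $1_{A_k}$.
  refine ⟨fun k => φ (ind (seg n k)), ?_, fun h => ?_⟩
  · have : ind (seg n 0) = 0 := by ext k; simp [ind, mem_seg]
    simp [this]
  · have key : previsionₗ n (fun k => φ (ind (seg n k))) = φ := by
      refine (Pi.basisFun ℝ (Fin n)).ext fun i => ?_
      have h1 : Pi.basisFun ℝ (Fin n) i = ind (pt n (i.val + 1)) := by
        ext k
        simp [ind, mem_pt, Pi.single_apply, Fin.ext_iff]
      have h2 : ind (pt n (i.val + 1)) = ind (seg n (i.val + 1)) - ind (seg n i.val) := by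
        ext k
        simp only [ind, mem_pt, mem_seg, Pi.sub_apply]
        split_ifs <;> first | omega | norm_num
      rw [h1, previsionₗ_apply, prevision_pt _ (by omega) (by omega)]
      simp [h2]
    exact LinearMap.congr_fun key h

/-! ### Bases of indicators -/

/-- The basis of indicators of the members of a generator family. -/
noncomputable def IsMESC.basis (hB : IsMESC B) : Module.Basis B ℝ (Fin n → ℝ) :=
  haveI : Nonempty B := ⟨⟨_, hB.univ_mem⟩⟩
  basisOfLinearIndependentOfCardEqFinrank (b := fun H : B => ind H.val)
    hB.linearIndep (by simp [hB.card_eq])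

theorem IsMESC.basis_apply (hB : IsMESC B) (H : B) : hB.basis H = ind H.val := by
  have : Nonempty B := ⟨⟨_, hB.univ_mem⟩⟩
  exact congrFun (coe_basisOfLinearIndependentOfCardEqFinrank _ _) H

theorem IsMESC.exists_sum (hB : IsMESC B) (h : Fin n → ℝ) :
    ∃ c : Finset (Fin n) → ℝ, h = ∑ H ∈ B, c H • ind H := by
  classical
  refine ⟨fun H => if hH : H ∈ B then hB.basis.repr h ⟨H, hH⟩ else 0, ?_⟩
  rw [← Finset.sum_coe_sort B]
  conv_lhs => rw [← hB.basis.sum_repr h]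
  refine Finset.sum_congr rfl fun H _ => ?_
  rw [hB.basis_apply]; simp

theorem IsMESC.prevision_ext (hB : IsMESC B) {F H : ℕ → ℝ}
    (h : ∀ G ∈ B, prevision F (ind G) = prevision H (ind G)) (x : Fin n → ℝ) :
    prevision F x = prevision H x := by
  obtain ⟨c, rfl⟩ := hB.exists_sum x
  rw [prevision_sum_smul, prevision_sum_smul]
  exact Finset.sum_congr rfl fun G hG => by rw [h G hG]

/-- The dual basis, as functions on `ℕ`. -/
theorem IsMESC.exists_dual (hB : IsMESC B) {G : Finset (Fin n)} (hG : G ∈ B) :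
    ∃ F : ℕ → ℝ, F 0 = 0 ∧ prevision F (ind G) = 1 ∧
      ∀ H ∈ B, H ≠ G → prevision F (ind H) = 0 := by
  obtain ⟨F, h0, hF⟩ := exists_prevision_eq (hB.basis.coord ⟨G, hG⟩)
  refine ⟨F, h0, ?_, fun H hH hne => ?_⟩
  · rw [hF, ← hB.basis_apply ⟨G, hG⟩]; simp
  · rw [hF, ← hB.basis_apply ⟨H, hH⟩]
    simp [hne]

theorem IsMESC.pos (hB : IsMESC B) : 0 < n := by
  rw [← hB.card_eq]; exact Finset.card_pos.2 ⟨_, hB.univ_mem⟩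

/-- A functional that kills a basis is zero. Applied to bumps, this is how the spanning property of
`B` enters. -/
theorem IsMESC.eq_of_annihilates (hB : IsMESC B) {F : ℕ → ℝ}
    (h : ∀ G ∈ B, prevision F (ind G) = 0) {k : ℕ} (hk : k ≤ n) : F k = F 0 := by
  have := hB.prevision_ext (F := F) (H := 0)
    (fun G hG => by rw [h G hG]; simp [prevision]) (ind (seg n k))
  rw [prevision_seg F hk, prevision_seg 0 hk] at this
  simpa [sub_eq_zero] using this

/-- A basis from a functional that separates the new element from the old ones. -/
theorem IsMESC.linearIndepOn_swap (hB : IsMESC B) {G G' : Finset (Fin n)} {F : ℕ → ℝ}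
    (h0 : ∀ H ∈ B, H ≠ G → prevision F (ind H) = 0) (h1 : prevision F (ind G') ≠ 0) :
    LinearIndepOn ℝ ind (swap B G G' : Set (Finset (Fin n))) := by
  rw [swap, Finset.coe_insert]
  refine LinearIndepOn.insert (hB.linearIndep.mono (by simp)) fun hmem => h1 ?_
  have : Submodule.span ℝ (ind '' (B.erase G : Set (Finset (Fin n)))) ≤
      LinearMap.ker (previsionₗ n F) := by
    rw [Submodule.span_le]
    rintro _ ⟨H, hH, rfl⟩
    simp only [Finset.coe_erase, Set.mem_sdiff, Finset.mem_coe, Set.mem_singleton_iff] at hH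
    simpa using h0 H hH.1 hH.2
  simpa using this hmem

theorem nonnegCone_subset_cone (S : Finset (Finset (Fin n))) : nonnegCone S ⊆ cone S := by
  rintro _ ⟨α, hα, rfl⟩
  by_cases hu : Finset.univ ∈ S
  · refine ⟨α, α Finset.univ, fun G hG => hα G (Finset.mem_of_mem_erase hG), ?_⟩
    rw [Finset.sum_erase_add _ _ hu]
  · refine ⟨α, 0, fun G hG => hα G (Finset.mem_of_mem_erase hG), ?_⟩
    rw [Finset.erase_eq_of_notMem hu]; simp

/-- When $\Omega$ is in the family, its real multiple is one more coefficient, of unrestricted sign.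
This lemma and the next pass between the two descriptions. -/
theorem sum_mem_cone {S : Finset (Finset (Fin n))} (hu : Finset.univ ∈ S)
    {α : Finset (Fin n) → ℝ} (hα : ∀ G ∈ S, G ≠ Finset.univ → 0 ≤ α G) :
    ∑ G ∈ S, α G • ind G ∈ cone S :=
  ⟨α, α Finset.univ, fun G hG => hα G (Finset.mem_of_mem_erase hG) (Finset.ne_of_mem_erase hG),
    by rw [Finset.sum_erase_add _ _ hu]⟩

theorem exists_sum_of_mem_cone {S : Finset (Finset (Fin n))} (hu : Finset.univ ∈ S)
    {h : Fin n → ℝ} (hh : h ∈ cone S) :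
    ∃ α : Finset (Fin n) → ℝ, (∀ G ∈ S, G ≠ Finset.univ → 0 ≤ α G) ∧
      h = ∑ G ∈ S, α G • ind G := by
  classical
  obtain ⟨α, β, hα, rfl⟩ := hh
  refine ⟨fun G => if G = Finset.univ then β else α G, fun G hG hne => ?_, ?_⟩
  · simpa [hne] using hα G (Finset.mem_erase.2 ⟨hne, hG⟩)
  · rw [← Finset.sum_erase_add _ _ hu]
    simp only [if_true]
    congr 1
    exact Finset.sum_congr rfl fun G hG => by simp [Finset.ne_of_mem_erase hG]

theorem ind_mem_cone {S : Finset (Finset (Fin n))} {G : Finset (Fin n)} (hG : G ∈ S) :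
    ind G ∈ cone S := by
  classical
  refine nonnegCone_subset_cone S ⟨fun H => if H = G then 1 else 0, fun H _ => ?_, ?_⟩
  · dsimp only; split_ifs <;> norm_num
  · simp [hG]

theorem sum_mem_nonnegCone {S T : Finset (Finset (Fin n))} (hT : T ⊆ S) :
    ∑ H ∈ T, ind H ∈ nonnegCone S := by
  classical
  refine ⟨fun H => if H ∈ T then 1 else 0, fun H _ => ?_, ?_⟩
  · dsimp only; split_ifs <;> norm_num
  · simp only [ite_smul, one_smul, zero_smul]
    rw [Finset.sum_ite_mem, Finset.inter_eq_right.2 hT]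

theorem add_mem_nonnegCone {S : Finset (Finset (Fin n))} {x y : Fin n → ℝ}
    (hx : x ∈ nonnegCone S) (hy : y ∈ nonnegCone S) : x + y ∈ nonnegCone S := by
  obtain ⟨α, hα, rfl⟩ := hx
  obtain ⟨β, hβ, rfl⟩ := hy
  refine ⟨α + β, fun G hG => add_nonneg (hα G hG) (hβ G hG), ?_⟩
  simp [add_smul, Finset.sum_add_distrib]

theorem ind_mem_nonnegCone {S : Finset (Finset (Fin n))} {G : Finset (Fin n)} (hG : G ∈ S) :
    ind G ∈ nonnegCone S := by
  simpa using sum_mem_nonnegCone (Finset.singleton_subset_iff.2 hG)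

theorem zero_mem_nonnegCone (S : Finset (Finset (Fin n))) : (0 : Fin n → ℝ) ∈ nonnegCone S := by
  simpa using sum_mem_nonnegCone (Finset.empty_subset S)

/-- The members that carry weight in a nonnegative representation of an indicator are subsets. -/
theorem subset_of_nonneg_sum {S : Finset (Finset (Fin n))} {α : Finset (Fin n) → ℝ}
    (hα : ∀ G ∈ S, 0 ≤ α G) {G H : Finset (Fin n)} (h : ind G = ∑ K ∈ S, α K • ind K)
    (hH : H ∈ S) (hpos : 0 < α H) : H ⊆ G := by
  intro x hx
  by_contra hxG
  -- At a point outside `G` the left side is $0$ and no term on the right is negative, so every term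
  -- vanishes.
  have h1 := congrFun h x
  simp only [ind, hxG, if_false, Finset.sum_apply, Pi.smul_apply, smul_eq_mul] at h1
  have h2 : ∀ K ∈ S, 0 ≤ α K * (if x ∈ K then (1 : ℝ) else 0) := fun K hK =>
    mul_nonneg (hα K hK) (by split_ifs <;> norm_num)
  have h3 := (Finset.sum_eq_zero_iff_of_nonneg h2).1 h1.symm H hH
  simp [hx] at h3
  exact hpos.ne' h3

/-! ### The chain and the singletons -/

theorem pos_zero : Pos B 0 := Or.inl rfl

theorem Pos.le {k : ℕ} (h : Pos B k) : k ≤ n := by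
  rcases h with rfl | h
  exacts [Nat.zero_le _, h.1]

theorem Pos.mem {k : ℕ} (h : Pos B k) (hk : 1 ≤ k) : seg n k ∈ B := by
  rcases h with rfl | h
  exacts [absurd hk (by omega), h.2]

theorem IsMESC.pos_last (hB : IsMESC B) : Pos B n :=
  Or.inr ⟨le_rfl, seg_self ▸ hB.univ_mem⟩

theorem le_of_chain {k : ℕ} (h : Pos B k ∨ Neg B k) : k ≤ n :=
  h.elim Pos.le fun h => h.2.1.le

theorem seg_nonempty {k : ℕ} (h0 : 1 ≤ k) (h1 : k ≤ n) : (seg n k).Nonempty :=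
  ⟨⟨0, by omega⟩, by rw [mem_seg]; exact h0⟩

theorem seg_ne_compl {k : ℕ} (h0 : 1 ≤ k) (h1 : k ≤ n) : seg n k ≠ (seg n k)ᶜ := fun h => by
  obtain ⟨x, hx⟩ := seg_nonempty h0 h1
  have h2 := hx
  rw [h, Finset.mem_compl] at h2
  exact h2 hx

/-- Both together would give the linear dependence $1_{A_k}+1_{A_k^c}=1_\Omega$, which the dual
vector of $A_k^c$ detects. -/
theorem IsMESC.not_pos_and_neg (hB : IsMESC B) {k : ℕ} (hp : Pos B k) (hn : Neg B k) : False := by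
  obtain ⟨h1, h2, h3⟩ := hn
  obtain ⟨F, h0, hF, hz⟩ := hB.exists_dual h3
  have hne : seg n k ≠ (seg n k)ᶜ := seg_ne_compl h1 h2.le
  have e1 := hz _ (hp.mem h1) hne
  have hu : (Finset.univ : Finset (Fin n)) ≠ (seg n k)ᶜ := fun h => by
    obtain ⟨x, hx⟩ := seg_nonempty h1 h2.le
    have := Finset.mem_univ x
    rw [h, Finset.mem_compl] at this
    exact this hx
  have e2 := hz _ hB.univ_mem hu
  rw [prevision_seg F h2.le] at e1
  rw [prevision_univ] at e2
  rw [prevision_compl F h2.le] at hF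
  linarith

/-- Every generator comes from the chain or is a singleton. -/
theorem IsMESC.mem_cases (hB : IsMESC B) {H : Finset (Fin n)} (hH : H ∈ B) :
    (∃ k, 1 ≤ k ∧ k ≤ n ∧ Pos B k ∧ H = seg n k) ∨ (∃ k, Neg B k ∧ H = (seg n k)ᶜ) ∨
      ∃ i, Sing B i ∧ H = pt n i := by
  rcases hB.isConstraintSet H hH with ⟨i, h1, h2, rfl⟩ | ⟨i, h1, h2, rfl⟩ | ⟨i, h1, h2, rfl⟩
  · exact Or.inl ⟨i, h1, h2, Or.inr ⟨h2, hH⟩, rfl⟩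
  · exact Or.inr (Or.inl ⟨i, ⟨h1, h2, hH⟩, rfl⟩)
  -- The extreme points are chain members in disguise: $\{x_1\}=A_1$ and $\{x_n\}=A_{n-1}^c$.
  · rcases h1.eq_or_lt with rfl | h1
    · exact Or.inl ⟨1, le_rfl, h2, Or.inr ⟨h2, pt_one (n := n) ▸ hH⟩, pt_one⟩
    · rcases h2.eq_or_lt with rfl | h2
      · exact Or.inr (Or.inl ⟨i - 1, ⟨by omega, by omega, pt_last (n := i) ▸ hH⟩, pt_last⟩)
      · exact Or.inr (Or.inr ⟨i, ⟨h1, h2, hH⟩, rfl⟩)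

/-- Take the last chain index below `i` and the first one from `i` on; they exist because $0$ and
$n$ belong to the chain. -/
theorem IsMESC.exists_consec (hB : IsMESC B) {i : ℕ} (h1 : 1 ≤ i) (hi : i ≤ n) :
    ∃ a b, Consec B a b ∧ a < i ∧ i ≤ b := by
  classical
  let P : ℕ → Prop := fun k => Pos B k ∨ Neg B k
  let Q : ℕ → Prop := fun k => i ≤ k ∧ P k
  have hQ : ∃ k, Q k := ⟨n, hi, Or.inl hB.pos_last⟩
  let a := Nat.findGreatest P (i - 1)
  have ha : a ≤ i - 1 := Nat.findGreatest_le _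
  refine ⟨a, Nat.find hQ, ⟨?_, (Nat.find_spec hQ).2, ?_, fun k hak hkb hk => ?_⟩, by omega,
    (Nat.find_spec hQ).1⟩
  · exact Nat.findGreatest_spec (P := P) (Nat.zero_le _) (Or.inl pos_zero)
  · have := (Nat.find_spec hQ).1
    omega
  · rcases Nat.lt_or_ge k i with hki | hki
    · exact Nat.findGreatest_is_greatest hak (by omega) hk
    · exact Nat.find_min hQ hkb ⟨hki, hk⟩

theorem IsMESC.exists_consec_right (hB : IsMESC B) {b : ℕ} (hb : Pos B b ∨ Neg B b)
    (hbn : b < n) : ∃ c, Consec B b c := by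
  obtain ⟨a, c, hc, h1, h2⟩ := hB.exists_consec (i := b + 1) (by omega) hbn
  have : a = b := by
    by_contra hne
    exact hc.2.2.2 b (by omega) (by omega) hb
  exact ⟨c, this ▸ hc⟩

theorem IsMESC.exists_consec_left (hB : IsMESC B) {b : ℕ} (hb : Pos B b ∨ Neg B b)
    (hb0 : 1 ≤ b) : ∃ a, Consec B a b := by
  obtain ⟨a, c, hc, h1, h2⟩ := hB.exists_consec (i := b) hb0 (le_of_chain hb)
  have : c = b := by
    by_contra hne
    exact hc.2.2.2 b (by omega) (by omega) hb
  exact ⟨a, this ▸ hc⟩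

theorem Consec.lt {a b : ℕ} (h : Consec B a b) : a < b := h.2.2.1

theorem Consec.le {a b : ℕ} (h : Consec B a b) : b ≤ n := le_of_chain h.2.1

/-! ### Bumps -/

/-- The indicator function of `{s, …, t}`. -/
noncomputable def bump (s t : ℕ) : ℕ → ℝ := fun k => if s ≤ k ∧ k ≤ t then 1 else 0

theorem bump_of_mem {s t k : ℕ} (h1 : s ≤ k) (h2 : k ≤ t) : bump s t k = 1 := by
  simp [bump, h1, h2]

theorem bump_of_lt {s t k : ℕ} (h : k < s) : bump s t k = 0 := by
  simp only [bump]; rw [if_neg]; omega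

theorem bump_of_gt {s t k : ℕ} (h : t < k) : bump s t k = 0 := by
  simp only [bump]; rw [if_neg]; omega

theorem bump_nonneg (s t k : ℕ) : 0 ≤ bump s t k := by
  simp only [bump]; split_ifs <;> norm_num

theorem prevision_bump_seg {s t k : ℕ} (hs : 1 ≤ s) (hk : k ≤ n) :
    prevision (bump s t) (ind (seg n k)) = bump s t k := by
  rw [prevision_seg _ hk, bump_of_lt (k := 0) (by omega), sub_zero]

theorem prevision_bump_compl {s t k : ℕ} (ht : t < n) (hk : k ≤ n) :
    prevision (bump s t) (ind (seg n k)ᶜ) = -bump s t k := by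
  rw [prevision_compl _ hk, bump_of_gt (k := n) (by omega), zero_sub]

theorem prevision_bump_pt_left {s t : ℕ} (hs : 1 ≤ s) (hst : s ≤ t) (ht : t < n) :
    prevision (bump s t) (ind (pt n s)) = 1 := by
  rw [prevision_pt _ hs (by omega), bump_of_mem le_rfl hst, bump_of_lt (by omega), sub_zero]

theorem prevision_bump_pt_right {s t : ℕ} (hst : s ≤ t) (ht : t < n) :
    prevision (bump s t) (ind (pt n (t + 1))) = -1 := by
  rw [prevision_pt _ (by omega) (by omega), bump_of_gt (by omega),
    bump_of_mem (by omega) (by omega), zero_sub]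

theorem prevision_bump_pt {s t i : ℕ} (h1 : 1 ≤ i) (hi : i ≤ n) (his : i ≠ s)
    (hit : i ≠ t + 1) : prevision (bump s t) (ind (pt n i)) = 0 := by
  rw [prevision_pt _ h1 hi]
  simp only [bump]
  split_ifs <;> first | omega | norm_num

theorem prevision_bump_univ {s t : ℕ} (hs : 1 ≤ s) (ht : t < n) :
    prevision (bump s t) (ind (Finset.univ : Finset (Fin n))) = 0 := by
  rw [prevision_univ, bump_of_gt ht, bump_of_lt (by omega), sub_zero]

/-- These are the only generators that a bump can see. Each hypothesis is met either because no such
generator exists or because `H` is a different one. -/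
theorem IsMESC.prevision_bump_eq_zero (hB : IsMESC B) {s t : ℕ} (hs : 1 ≤ s)
    (ht : t < n) {H : Finset (Fin n)} (hH : H ∈ B)
    (h1 : ∀ k, s ≤ k → k ≤ t → Pos B k → H ≠ seg n k)
    (h2 : ∀ k, s ≤ k → k ≤ t → Neg B k → H ≠ (seg n k)ᶜ)
    (h3 : Sing B s → H ≠ pt n s) (h4 : Sing B (t + 1) → H ≠ pt n (t + 1)) :
    prevision (bump s t) (ind H) = 0 := by
  rcases hB.mem_cases hH with ⟨k, hk1, hk2, hp, rfl⟩ | ⟨k, hk, rfl⟩ | ⟨i, hi, rfl⟩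
  · rw [prevision_bump_seg hs hk2, bump, if_neg]
    exact fun h => h1 k h.1 h.2 hp rfl
  · rw [prevision_bump_compl ht hk.2.1.le, bump, if_neg, neg_zero]
    exact fun h => h2 k h.1 h.2 hk rfl
  · refine prevision_bump_pt (by have := hi.1; omega) hi.2.1.le ?_ ?_
    · rintro rfl; exact h3 hi rfl
    · rintro rfl; exact h4 hi rfl

/-! ### The missing indices -/

theorem not_sing_last : ¬ Sing B n := fun h => lt_irrefl _ h.2.1

/-- If all points of $A_b\setminus A_a$ were singletons of `B`, then $1_{A_b}-1_{A_a}$ would be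
their sum, a dependence with $\Omega$ supplying the complements. Concretely, the dual vector of the
chain member at `b` would be constant from `a` to `b` and equal to its value at `n`, whereas it must
separate `b` from `n`. -/
theorem IsMESC.exists_missing (hB : IsMESC B) {a b : ℕ} (h : Consec B a b) :
    ∃ j, Missing B a b j := by
  by_contra! hno
  have hs : ∀ l, a < l → l ≤ b → Sing B l := fun l h1 h2 => by
    by_contra h3; exact hno l ⟨h1, h2, h3⟩
  have hab := h.lt
  have hbs := hs b hab le_rfl
  have hbn : b < n := hbs.2.1
  -- a function that is nonzero at `b` and annihilates the other generators
  obtain ⟨G, hG, F, h0, hF, hz, hne⟩ : ∃ G ∈ B, ∃ F : ℕ → ℝ, F 0 = 0 ∧ F b - F n ≠ 0 ∧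
      (∀ H ∈ B, H ≠ G → prevision F (ind H) = 0) ∧ (G = seg n b ∨ G = (seg n b)ᶜ) := by
    rcases h.2.1 with hp | hp
    · obtain ⟨F, h0, hF, hz⟩ := hB.exists_dual (hp.mem (by omega))
      refine ⟨_, hp.mem (by omega), F, h0, ?_, hz, Or.inl rfl⟩
      have hu := hz _ hB.univ_mem fun hu => by
        have := Finset.mem_univ (⟨b, hbn⟩ : Fin n)
        rw [hu, mem_seg] at this
        exact lt_irrefl _ this
      rw [prevision_univ] at hu
      rw [prevision_seg F hbn.le] at hF
      rw [show F b - F n = 1 by linarith]; norm_num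
    · obtain ⟨F, h0, hF, hz⟩ := hB.exists_dual hp.2.2
      refine ⟨_, hp.2.2, F, h0, ?_, hz, Or.inr rfl⟩
      rw [prevision_compl F hbn.le] at hF
      rw [show F b - F n = -1 by linarith]; norm_num
  have hb0 : (⟨b, hbn⟩ : Fin n) ∉ seg n b := by simp [mem_seg]
  have hb1 : (⟨b - 1, by omega⟩ : Fin n) ∈ seg n b := by rw [mem_seg]; simp; omega
  have hu : F n = 0 := by
    have := hz _ hB.univ_mem fun hu => by
      rcases hne with rfl | rfl
      · exact hb0 (hu ▸ Finset.mem_univ _)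
      · have := Finset.mem_univ (⟨b - 1, by omega⟩ : Fin n)
        rw [hu, Finset.mem_compl] at this
        exact this hb1
    rw [prevision_univ, h0, sub_zero] at this
    exact this
  have hconst : ∀ d, a + d ≤ b → F (a + d) = F a := by
    intro d
    induction d with
    | zero => intro _; rfl
    | succ d ih =>
      intro hd
      have hsl := hs (a + (d + 1)) (by omega) hd
      -- An inner singleton contains neither $x_1$ nor $x_n$, while $A_b$ contains the first and
      -- $A_b^c$ the second; hence it is not `G`.
      have := hz _ hsl.2.2 fun hp => by
        have h00 : (⟨0, by omega⟩ : Fin n) ∉ pt n (a + (d + 1)) := by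
          rw [mem_pt]; have := hsl.1; simp; omega
        have h11 : (⟨n - 1, by omega⟩ : Fin n) ∉ pt n (a + (d + 1)) := by
          rw [mem_pt]; have := hsl.2.1; simp; omega
        rw [hp] at h00 h11
        rcases hne with rfl | rfl
        · exact h00 (by rw [mem_seg]; simp; omega)
        · exact h11 (by rw [Finset.mem_compl, mem_seg]; simp; omega)
      rw [prevision_pt F (by omega) (by omega), show a + (d + 1) - 1 = a + d by omega] at this
      rw [← ih (by omega)]; linarith
  have hba := hconst (b - a) (by omega)
  rw [show a + (b - a) = b by omega] at hba
  have ha0 : F a = 0 := by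
    rcases Nat.eq_zero_or_pos a with rfl | ha
    · exact h0
    have hxa : (⟨a, by omega⟩ : Fin n) ∈ seg n b := by rw [mem_seg]; exact hab
    have hya : (⟨a, by omega⟩ : Fin n) ∉ seg n a := by simp [mem_seg]
    have hx0 : (⟨0, by omega⟩ : Fin n) ∈ seg n b := by rw [mem_seg]; simp; omega
    have hy0 : (⟨0, by omega⟩ : Fin n) ∈ seg n a := by rw [mem_seg]; exact ha
    rcases h.1 with hp | hp
    · have := hz _ (hp.mem ha) fun he => by
        rcases hne with rfl | rfl
        · exact hya (he ▸ hxa)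
        · rw [he, Finset.mem_compl] at hy0; exact hy0 hx0
      rw [prevision_seg F (by omega), h0, sub_zero] at this
      exact this
    · have := hz _ hp.2.2 fun he => by
        rcases hne with rfl | rfl
        · rw [← he, Finset.mem_compl] at hx0; exact hx0 hy0
        · rw [compl_inj_iff.1 he] at hya; exact hya hxa
      rw [prevision_compl F (by omega), hu] at this
      linarith
  exact hF (by rw [hba, ha0, hu, sub_zero])

/-- For two missing indices $j<j'$, the bump on $\{j,\dots,j'-1\}$ lies strictly between the chain
members, and neither of its jumps, at $x_j$ and at $x_{j'}$, is seen by a singleton. It therefore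
annihilates the whole basis. -/
theorem IsMESC.missing_unique (hB : IsMESC B) {a b j j' : ℕ} (h : Consec B a b)
    (hj : Missing B a b j) (hj' : Missing B a b j') : j = j' := by
  wlog hlt : j < j' generalizing j j'
  · rcases Nat.lt_trichotomy j j' with h1 | h1 | h1
    exacts [absurd h1 hlt, h1, (this hj' hj h1).symm]
  exfalso
  have hb := h.le
  obtain ⟨h1, h2, h3⟩ := hj
  obtain ⟨h1', h2', h3'⟩ := hj'
  have key := hB.eq_of_annihilates (F := bump j (j' - 1)) (k := j) (fun G hG => by
    refine hB.prevision_bump_eq_zero (by omega) (by omega) hG ?_ ?_ ?_ ?_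
    · intro k hk1 hk2 hk
      exact absurd (Or.inl hk) (h.2.2.2 k (by omega) (by omega))
    · intro k hk1 hk2 hk
      exact absurd (Or.inr hk) (h.2.2.2 k (by omega) (by omega))
    · exact fun hs => absurd hs h3
    · rw [show j' - 1 + 1 = j' by omega]; exact fun hs => absurd hs h3') (by omega)
  rw [bump_of_mem le_rfl (by omega), bump_of_lt (by omega)] at key
  exact one_ne_zero key

theorem IsMESC.sing_of_ne_missing (hB : IsMESC B) {a b j l : ℕ} (h : Consec B a b)
    (hj : Missing B a b j) (h1 : a < l) (h2 : l ≤ b) (hne : l ≠ j) : Sing B l := by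
  by_contra h3
  exact hne (hB.missing_unique h ⟨h1, h2, h3⟩ hj)

theorem ind_seg_add_pt {k : ℕ} (hk : 1 ≤ k) :
    (ind (seg n k) : Fin n → ℝ) = ind (seg n (k - 1)) + ind (pt n k) := by
  ext x
  simp only [ind, mem_seg, mem_pt, Pi.add_apply]
  split_ifs <;> first | omega | norm_num

theorem ind_compl_add_pt {k : ℕ} (hk : 1 ≤ k) :
    (ind (seg n (k - 1))ᶜ : Fin n → ℝ) = ind (seg n k)ᶜ + ind (pt n k) := by
  ext x
  simp only [ind, mem_seg, mem_pt, Finset.mem_compl, Pi.add_apply]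
  split_ifs <;> first | omega | norm_num

/-- Otherwise $1_{A_{a+1}}=1_{A_a}+1_{\{x_{a+1}\}}$ violates elementarity: the missing index lies
further right, so $a+1<b$ and $A_{a+1}$ is not in `B`. -/
theorem IsMESC.missing_of_pos_left (hB : IsMESC B) {a b : ℕ} (h : Consec B a b)
    (ha : Pos B a) : Missing B a b (a + 1) := by
  obtain ⟨j, hj⟩ := hB.exists_missing h
  have hab := h.lt
  have hbn := h.le
  by_contra hno
  have hs : Sing B (a + 1) := by
    by_contra hs; exact hno ⟨by omega, by omega, hs⟩
  have hne : a + 1 ≠ j := fun he => hj.2.2 (he ▸ hs)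
  have h1 := hj.1
  have h2 := hj.2.1
  have ha1 : 1 ≤ a := by have := hs.1; omega
  refine hB.elementary (seg n (a + 1)) (Or.inl ⟨a + 1, by omega, by omega, rfl⟩) (fun hm => ?_) ?_
  · exact h.2.2.2 (a + 1) (by omega) (by omega) (Or.inl (Or.inr ⟨by omega, hm⟩))
  · rw [ind_seg_add_pt (by omega), Nat.add_sub_cancel]
    exact add_mem_nonnegCone (ind_mem_nonnegCone (ha.mem ha1)) (ind_mem_nonnegCone hs.2.2)

/-- The mirror image, with $1_{A_{b-1}^c}=1_{A_b^c}+1_{\{x_b\}}$. -/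
theorem IsMESC.missing_of_neg_right (hB : IsMESC B) {a b : ℕ} (h : Consec B a b)
    (hb : Neg B b) : Missing B a b b := by
  obtain ⟨j, hj⟩ := hB.exists_missing h
  have hab := h.lt
  have hbn := h.le
  by_contra hno
  have hs : Sing B b := by
    by_contra hs; exact hno ⟨by omega, by omega, hs⟩
  have hne : b ≠ j := fun he => hj.2.2 (he ▸ hs)
  have h1 := hj.1
  have h2 := hj.2.1
  refine hB.elementary (seg n (b - 1))ᶜ (Or.inr (Or.inl ⟨b - 1, by omega, by omega, rfl⟩))
    (fun hm => ?_) ?_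
  · exact h.2.2.2 (b - 1) (by omega) (by omega) (Or.inr ⟨by omega, by omega, hm⟩)
  · rw [ind_compl_add_pt (by omega)]
    exact add_mem_nonnegCone (ind_mem_nonnegCone hb.2.2) (ind_mem_nonnegCone hs.2.2)

/-! ### Faces of the cones -/

theorem cone_mono {S T : Finset (Finset (Fin n))} (h : S ⊆ T) : cone S ⊆ cone T := by
  classical
  rintro _ ⟨α, β, hα, rfl⟩
  refine ⟨fun H => if H ∈ S then α H else 0, β, fun H hH => ?_, ?_⟩
  · dsimp only
    split_ifs with hS
    · exact hα H (Finset.mem_erase.2 ⟨Finset.ne_of_mem_erase hH, hS⟩)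
    · exact le_rfl
  · congr 1
    have : ∑ H ∈ T.erase Finset.univ, (if H ∈ S then α H else 0) • (ind H : Fin n → ℝ) =
        ∑ H ∈ S.erase Finset.univ, (if H ∈ S then α H else 0) • ind H := by
      refine (Finset.sum_subset (Finset.erase_subset_erase _ h) fun H hT hS => ?_).symm
      have : H ∉ S := fun hm => hS (Finset.mem_erase.2 ⟨Finset.ne_of_mem_erase hT, hm⟩)
      simp [this]
    rw [this]
    exact Finset.sum_congr rfl fun H hH => by simp [Finset.mem_of_mem_erase hH]

theorem zero_mem_cone (S : Finset (Finset (Fin n))) : (0 : Fin n → ℝ) ∈ cone S :=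
  nonnegCone_subset_cone S (zero_mem_nonnegCone S)

theorem smul_univ_mem_cone (S : Finset (Finset (Fin n))) (β : ℝ) :
    β • (ind Finset.univ : Fin n → ℝ) ∈ cone S :=
  ⟨0, β, fun _ _ => le_rfl, by simp⟩

theorem cone_subset_span {S : Finset (Finset (Fin n))} (hu : Finset.univ ∈ S) :
    cone S ⊆ Submodule.span ℝ (ind '' (S : Set (Finset (Fin n)))) := by
  intro x hx
  obtain ⟨α, -, rfl⟩ := exists_sum_of_mem_cone hu hx
  exact Submodule.sum_mem _ fun H hH =>
    Submodule.smul_mem _ _ (Submodule.subset_span ⟨H, hH, rfl⟩)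

/-- Splitting off one generator. -/
theorem exists_split {S : Finset (Finset (Fin n))} {K : Finset (Fin n)} (hu : Finset.univ ∈ S)
    (hK : K ∈ S) (hKu : K ≠ Finset.univ) {x : Fin n → ℝ} (hx : x ∈ cone S) :
    ∃ r : ℝ, 0 ≤ r ∧ ∃ y ∈ cone (S.erase K), x = r • ind K + y := by
  obtain ⟨α, hα, rfl⟩ := exists_sum_of_mem_cone hu hx
  refine ⟨α K, hα K hK hKu, ∑ H ∈ S.erase K, α H • ind H, ?_, ?_⟩
  · exact sum_mem_cone (Finset.mem_erase.2 ⟨hKu.symm, hu⟩)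
      fun H hH hne => hα H (Finset.mem_of_mem_erase hH) hne
  · rw [add_comm, Finset.sum_erase_add _ _ hK]

theorem prevision_eq_zero_of_mem_cone {S : Finset (Finset (Fin n))} {F : ℕ → ℝ}
    (hu : Finset.univ ∈ S)
    (hz : ∀ H ∈ S, prevision F (ind H) = 0) {x : Fin n → ℝ} (hx : x ∈ cone S) :
    prevision F x = 0 := by
  obtain ⟨α, -, rfl⟩ := exists_sum_of_mem_cone hu hx
  rw [prevision_sum_smul]
  exact Finset.sum_eq_zero fun H hH => by rw [hz H hH, mul_zero]

theorem IsMESC.span_eq_top (hB : IsMESC B) :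
    Submodule.span ℝ (ind '' (B : Set (Finset (Fin n)))) = ⊤ := by
  rw [eq_top_iff]
  rintro x -
  obtain ⟨c, rfl⟩ := hB.exists_sum x
  exact Submodule.sum_mem _ fun H hH =>
    Submodule.smul_mem _ _ (Submodule.subset_span ⟨H, hH, rfl⟩)

theorem finrank_span_ind {S : Finset (Finset (Fin n))}
    (hS : LinearIndepOn ℝ ind (S : Set (Finset (Fin n)))) :
    Module.finrank ℝ (Submodule.span ℝ (ind '' (S : Set (Finset (Fin n))))) = S.card := by
  have h := finrank_span_eq_card (R := ℝ) (b := fun H : S => (ind H.val : Fin n → ℝ)) hS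
  rw [Fintype.card_coe] at h
  rw [← h, Set.image_eq_range]
  rfl

theorem swap_eq_insert {G G' : Finset (Fin n)} : swap B G G' = insert G' (B.erase G) := rfl

theorem erase_subset_swap {G G' : Finset (Fin n)} : B.erase G ⊆ swap B G G' :=
  Finset.subset_insert _ _

theorem mem_swap_self {G G' : Finset (Fin n)} : G' ∈ swap B G G' := Finset.mem_insert_self _ _

theorem mem_swap_of_ne {G G' H : Finset (Fin n)} (hH : H ∈ B) (hne : H ≠ G) :
    H ∈ swap B G G' := erase_subset_swap (Finset.mem_erase.2 ⟨hne, hH⟩)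

theorem erase_swap {G G' : Finset (Fin n)} (h : G' ∉ B) : (swap B G G').erase G' = B.erase G :=
  Finset.erase_insert fun hm => h (Finset.mem_of_mem_erase hm)

theorem finrank_span_lt {C : Set (Fin n → ℝ)}
    (h : Module.finrank ℝ (Submodule.span ℝ C) + 1 = n) : Submodule.span ℝ C ≠ ⊤ := by
  intro ht
  rw [ht, finrank_top] at h
  simp at h

/-- The cones of two families that differ in one generator are adjacent exactly if the two
generators lie on different sides of the common hyperplane. -/
theorem IsMESC.conesAdjacent_swap_iff (hB : IsMESC B) {G G' : Finset (Fin n)} {F : ℕ → ℝ}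
    (hG : G ∈ B) (hGu : G ≠ Finset.univ) (hG' : G' ∉ B) (hB' : IsMESC (swap B G G'))
    (h1 : prevision F (ind G) = 1) (h0 : ∀ H ∈ B, H ≠ G → prevision F (ind H) = 0) :
    ConesAdjacent (cone B) (cone (swap B G G')) ↔ prevision F (ind G') < 0 := by
  have hu := hB.univ_mem
  have hue : Finset.univ ∈ B.erase G := Finset.mem_erase.2 ⟨hGu.symm, hu⟩
  have hze : ∀ H ∈ B.erase G, prevision F (ind H) = 0 := fun H hH =>
    h0 H (Finset.mem_of_mem_erase hH) (Finset.ne_of_mem_erase hH)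
  constructor
  · intro hadj
    by_contra! hge
    -- If `G'` lay in the hyperplane, `F` would annihilate the new basis and so be constant.
    have hne : prevision F (ind G') ≠ 0 := fun hz => by
      have hk : ∀ k, k ≤ n → F k = F 0 := fun k hk => hB'.eq_of_annihilates (F := F)
        (fun H hH => by
          rcases Finset.mem_insert.1 hH with rfl | hH
          exacts [hz, hze H hH]) hk
      have : prevision F (ind G) = 0 := by
        rw [prevision_ind]
        exact Finset.sum_eq_zero fun k _ => by rw [hk _ k.isLt, hk _ k.isLt.le, sub_self]
      linarith
    have hpos : 0 < prevision F (ind G') := lt_of_le_of_ne hge hne.symm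
    obtain ⟨c, hc⟩ := hB.exists_sum (ind G')
    have hcG : c G = prevision F (ind G') := by
      rw [hc, prevision_sum_smul, Finset.sum_eq_single_of_mem G hG
        (fun H hH hne => by rw [h0 H hH hne, mul_zero]), h1, mul_one]
    -- Adding the shared generators with weights $|c_H|$ makes all coefficients nonnegative in both
    -- families and keeps that of `G` positive. If `G'` were on the side of `G`, the intersection of
    -- the cones would thus span everything.
    set z : Fin n → ℝ := ∑ H ∈ B.erase G, |c H| • ind H with hz
    have hy1 : ind G' + z ∈ cone (swap B G G') := by
      refine nonnegCone_subset_cone _ (add_mem_nonnegCone (ind_mem_nonnegCone mem_swap_self) ?_)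
      refine ⟨fun H => if H ∈ B.erase G then |c H| else 0, fun H _ => ?_, ?_⟩
      · dsimp only; split_ifs <;> simp
      · simp only [ite_smul, zero_smul]
        rw [Finset.sum_ite_mem, Finset.inter_eq_right.2 erase_subset_swap]
    have hyeq : ind G' + z = c G • ind G + ∑ H ∈ B.erase G, (c H + |c H|) • ind H := by
      conv_lhs => rw [hc, ← Finset.add_sum_erase _ _ hG]
      rw [hz, add_assoc, ← Finset.sum_add_distrib]
      simp only [add_smul]
    have hy2 : ind G' + z ∈ cone B := by
      rw [hyeq]
      have : c G • (ind G : Fin n → ℝ) + ∑ H ∈ B.erase G, (c H + |c H|) • ind H =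
          ∑ H ∈ B, (c H + |c H| - if H = G then c G else 0) • ind H := by
        rw [← Finset.add_sum_erase _ _ hG]
        congr 1
        · rw [if_pos rfl, abs_of_nonneg (hcG ▸ hge), add_sub_cancel_right]
        · exact Finset.sum_congr rfl fun H hH => by
            rw [if_neg (Finset.ne_of_mem_erase hH), sub_zero]
      rw [this]
      refine sum_mem_cone hu fun H hH _ => ?_
      split_ifs with he
      · rw [he, abs_of_nonneg (hcG ▸ hge)]; linarith [hcG ▸ hge]
      · linarith [neg_abs_le (c H)]
    refine finrank_span_lt hadj.2.2 ?_
    set V := Submodule.span ℝ (cone B ∩ cone (swap B G G')) with hV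
    have he : ∀ H ∈ B.erase G, ind H ∈ V := fun H hH =>
      Submodule.subset_span ⟨ind_mem_cone (Finset.mem_of_mem_erase hH),
        ind_mem_cone (erase_subset_swap hH)⟩
    have hyV : ind G' + z ∈ V := Submodule.subset_span ⟨hy2, hy1⟩
    have hGV : ind G ∈ V := by
      rw [hyeq] at hyV
      have h2 := (Submodule.add_mem_iff_left V (Submodule.sum_mem V fun H hH =>
        Submodule.smul_mem V _ (he H hH))).1 hyV
      exact (Submodule.smul_mem_iff V (by rw [hcG]; exact hne)).1 h2
    rw [eq_top_iff, ← hB.span_eq_top, Submodule.span_le]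
    rintro _ ⟨H, hH, rfl⟩
    by_cases hHG : H = G
    · rw [hHG]; exact hGV
    · exact he H (Finset.mem_erase.2 ⟨hHG, hH⟩)
  · intro hneg
    have hG'u : G' ≠ Finset.univ := fun h => hG' (h ▸ hu)
    -- `F` separates the two cones, and each touches the hyperplane only in the cone of the shared
    -- generators.
    have hC : ∀ x ∈ cone B, 0 ≤ prevision F x ∧
        (prevision F x = 0 → x ∈ cone (B.erase G)) := by
      intro x hx
      obtain ⟨r, hr, y, hy, rfl⟩ := exists_split hu hG hGu hx
      have hv : prevision F (r • ind G + y) = r := by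
        rw [← previsionₗ_apply, map_add, map_smul, previsionₗ_apply, previsionₗ_apply, h1,
          prevision_eq_zero_of_mem_cone hue hze hy]
        simp
      rw [hv]
      refine ⟨hr, fun h => ?_⟩
      rw [h, zero_smul, zero_add]; exact hy
    have hD : ∀ x ∈ cone (swap B G G'), prevision F x ≤ 0 ∧
        (prevision F x = 0 → x ∈ cone (B.erase G)) := by
      intro x hx
      obtain ⟨r, hr, y, hy, rfl⟩ := exists_split hB'.univ_mem mem_swap_self hG'u hx
      rw [erase_swap hG'] at hy
      have hv : prevision F (r • ind G' + y) = r * prevision F (ind G') := by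
        rw [← previsionₗ_apply, map_add, map_smul, previsionₗ_apply, previsionₗ_apply,
          prevision_eq_zero_of_mem_cone hue hze hy]
        simp
      rw [hv]
      refine ⟨mul_nonpos_of_nonneg_of_nonpos hr hneg.le, fun h => ?_⟩
      rw [(mul_eq_zero.1 h).resolve_right hneg.ne, zero_smul, zero_add]; exact hy
    have hCD : cone B ∩ cone (swap B G G') = cone (B.erase G) := by
      refine Set.Subset.antisymm (fun x hx => ?_) (fun x hx =>
        ⟨cone_mono (Finset.erase_subset _ _) hx, cone_mono erase_subset_swap hx⟩)
      exact (hC x hx.1).2 (le_antisymm (hD x hx.2).1 (hC x hx.1).1)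
    -- An exposed face is where a functional is maximal: $-F$ has maximum $0$ on the first cone, $F$
    -- on the second.
    refine ⟨fun _ => ⟨(-previsionₗ n F).toContinuousLinearMap, ?_⟩,
      fun _ => ⟨(previsionₗ n F).toContinuousLinearMap, ?_⟩, ?_⟩
    · rw [hCD]
      ext x
      simp only [Set.mem_ofPred_eq, LinearMap.coe_toContinuousLinearMap', LinearMap.neg_apply,
        previsionₗ_apply]
      constructor
      · intro hx
        refine ⟨cone_mono (Finset.erase_subset _ _) hx, fun y hy => ?_⟩
        rw [prevision_eq_zero_of_mem_cone hue hze hx]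
        linarith [(hC y hy).1]
      · rintro ⟨hx, hm⟩
        have := hm 0 (zero_mem_cone B)
        rw [← previsionₗ_apply F 0, map_zero] at this
        exact (hC x hx).2 (le_antisymm (by linarith) (hC x hx).1)
    · rw [hCD]
      ext x
      simp only [Set.mem_ofPred_eq, LinearMap.coe_toContinuousLinearMap', previsionₗ_apply]
      constructor
      · intro hx
        refine ⟨cone_mono erase_subset_swap hx, fun y hy => ?_⟩
        rw [prevision_eq_zero_of_mem_cone hue hze hx]
        exact (hD y hy).1
      · rintro ⟨hx, hm⟩
        have := hm 0 (zero_mem_cone _)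
        rw [← previsionₗ_apply F 0, map_zero] at this
        exact (hD x hx).2 (le_antisymm (hD x hx).1 (by linarith))
    · rw [hCD]
      have : Submodule.span ℝ (cone (B.erase G)) =
          Submodule.span ℝ (ind '' (B.erase G : Set (Finset (Fin n)))) := by
        refine le_antisymm (Submodule.span_le.2 ?_) (Submodule.span_mono ?_)
        · exact cone_subset_span hue
        · rintro _ ⟨H, hH, rfl⟩
          exact ind_mem_cone hH
      rw [this, finrank_span_ind (hB.linearIndep.mono (by simp)),
        Finset.card_erase_of_mem hG, hB.card_eq]
      have := hB.pos
      omega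

/-! ### Adjacent cones share all generators but one -/

/-- The generators that carry weight in an element of an exposed face lie in that face. -/
theorem ind_mem_of_isExposed {S : Finset (Finset (Fin n))} {X : Set (Fin n → ℝ)}
    (hu : Finset.univ ∈ S) (hX : IsExposed ℝ (cone S) X) (h0 : 0 ∈ X)
    {α : Finset (Fin n) → ℝ} (hα : ∀ H ∈ S, H ≠ Finset.univ → 0 ≤ α H)
    (hx : ∑ H ∈ S, α H • ind H ∈ X) {H : Finset (Fin n)} (hH : H ∈ S) (hne : α H ≠ 0) :
    ind H ∈ X := by
  -- Since $0$ is in the face, the exposing functional has maximum $0$, and the face is its zero set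
  -- in the cone.
  obtain ⟨l, hl⟩ := hX ⟨0, h0⟩
  have hle : ∀ y ∈ cone S, l y ≤ 0 := fun y hy => by
    have := h0
    rw [hl] at this
    simpa using this.2 y hy
  have hmem : ∀ y ∈ cone S, l y = 0 → y ∈ X := fun y hy hy0 => by
    rw [hl]
    exact ⟨hy, fun z hz => hy0 ▸ hle z hz⟩
  -- Both signs of $1_\Omega$ lie in the cone. This handles the one coefficient whose sign is free.
  have hlu : l (ind Finset.univ) = 0 := by
    have h1 := hle _ (smul_univ_mem_cone S 1)
    have h2 := hle _ (smul_univ_mem_cone S (-1))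
    simp only [map_smul, smul_eq_mul] at h1 h2
    linarith
  have hx0 : l (∑ H ∈ S, α H • ind H) = 0 := by
    refine le_antisymm (hle _ (sum_mem_cone hu hα)) ?_
    rw [hl] at hx
    simpa using hx.2 0 (zero_mem_cone S)
  simp only [map_sum, map_smul, smul_eq_mul] at hx0
  have hterm : ∀ K ∈ S, α K * l (ind K) ≤ 0 := fun K hK => by
    by_cases hKu : K = Finset.univ
    · rw [hKu, hlu, mul_zero]
    · exact mul_nonpos_of_nonneg_of_nonpos (hα K hK hKu) (hle _ (ind_mem_cone hK))
  have := (Finset.sum_eq_zero_iff_of_nonpos hterm).1 hx0 H hH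
  exact hmem _ (ind_mem_cone hH) ((mul_eq_zero.1 this).resolve_left hne)

theorem prevision_dual_nonneg {S : Finset (Finset (Fin n))} {F : ℕ → ℝ} {K : Finset (Fin n)}
    (hu : Finset.univ ∈ S) (hK : K ∈ S) (hKu : K ≠ Finset.univ) (h1 : prevision F (ind K) = 1)
    (h0 : ∀ H ∈ S, H ≠ K → prevision F (ind H) = 0) {x : Fin n → ℝ} (hx : x ∈ cone S) :
    0 ≤ prevision F x := by
  obtain ⟨α, hα, rfl⟩ := exists_sum_of_mem_cone hu hx
  rw [prevision_sum_smul, Finset.sum_eq_single_of_mem K hK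
    (fun H hH hne => by rw [h0 H hH hne, mul_zero]), h1, mul_one]
  exact hα K hK hKu

/-- On `H` the right side is $r+\beta$ and off `H` it is $\beta$; both values are $0$ or $1$ and
$r>0$, so $\beta=0$ and $r=1$. -/
theorem eq_of_ind_eq_smul_add {G H : Finset (Fin n)} {r β : ℝ} (hr : 0 < r) (hne : H.Nonempty)
    (hu : H ≠ Finset.univ) (h : (ind G : Fin n → ℝ) = r • ind H + β • ind Finset.univ) :
    G = H := by
  obtain ⟨x, hx⟩ := hne
  obtain ⟨y, hy⟩ : ∃ y, y ∉ H := by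
    by_contra! hall
    exact hu (Finset.eq_univ_of_forall hall)
  have key : ∀ z, (if z ∈ G then (1 : ℝ) else 0) = r * (if z ∈ H then 1 else 0) + β := fun z => by
    have := congrFun h z
    simpa [ind] using this
  have hx' := key x
  have hy' := key y
  rw [if_pos hx, mul_one] at hx'
  rw [if_neg hy, mul_zero, zero_add] at hy'
  have hβ : β = 0 := by
    split_ifs at hx' hy' <;> linarith
  have hr1 : r = 1 := by
    split_ifs at hx' <;> linarith
  ext z
  have := key z
  rw [hβ, hr1] at this
  constructor <;> intro hz <;> by_contra hz' <;> simp [hz, hz'] at this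

/-- A generator of a common exposed face of two cones belongs to both families. -/
theorem IsMESC.mem_of_common_face (hB : IsMESC B) {B' : Finset (Finset (Fin n))}
    (hB' : IsMESC B') (hX : IsExposed ℝ (cone B') (cone B ∩ cone B')) {H : Finset (Fin n)}
    (hH : H ∈ B) (hHX : ind H ∈ cone B ∩ cone B') : H ∈ B' := by
  by_cases hHu : H = Finset.univ
  · rw [hHu]; exact hB'.univ_mem
  obtain ⟨L, -, hL1, hL0⟩ := hB.exists_dual hH
  have hX0 : (0 : Fin n → ℝ) ∈ cone B ∩ cone B' := ⟨zero_mem_cone _, zero_mem_cone _⟩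
  obtain ⟨α, hα, hsum⟩ := exists_sum_of_mem_cone hB'.univ_mem hHX.2
  -- The plan: expand `H` in `B'`, pick a member `K` of weight that is visible to the dual vector of
  -- `H`, and expand `K` back in `B`. The members that carry weight lie in the face, hence in `cone
  -- B`.
  have hface : ∀ K ∈ B', α K ≠ 0 → ind K ∈ cone B := fun K hK hne =>
    (ind_mem_of_isExposed hB'.univ_mem hX hX0 hα (hsum ▸ hHX) hK hne).1
  obtain ⟨K, hK, hKne⟩ : ∃ K ∈ B', α K * prevision L (ind K) ≠ 0 := by
    refine Finset.exists_ne_zero_of_sum_ne_zero ?_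
    rw [← prevision_sum_smul, ← hsum, hL1]
    exact one_ne_zero
  have hαK := left_ne_zero_of_mul hKne
  have hLK := right_ne_zero_of_mul hKne
  have hLpos : 0 < prevision L (ind K) :=
    lt_of_le_of_ne (prevision_dual_nonneg hB.univ_mem hH hHu hL1 hL0 (hface K hK hαK)) hLK.symm
  obtain ⟨c, hc⟩ := hB.exists_sum (ind K)
  have hcH : c H = prevision L (ind K) := by
    rw [hc, prevision_sum_smul, Finset.sum_eq_single_of_mem H hH
      (fun J hJ hne => by rw [hL0 J hJ hne, mul_zero]), hL1, mul_one]
  -- The dual vector of `J` vanishes at `H`, so its nonnegative values on the expansion of `H` all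
  -- vanish, in particular the one at `K`.
  have hc0 : ∀ J ∈ B, J ≠ H → J ≠ Finset.univ → c J = 0 := by
    intro J hJ hJH hJu
    obtain ⟨M, -, hM1, hM0⟩ := hB.exists_dual hJ
    have hcJ : c J = prevision M (ind K) := by
      rw [hc, prevision_sum_smul, Finset.sum_eq_single_of_mem J hJ
        (fun I hI hne => by rw [hM0 I hI hne, mul_zero]), hM1, mul_one]
    have hs : ∑ I ∈ B', α I * prevision M (ind I) = 0 := by
      rw [← prevision_sum_smul, ← hsum, hM0 H hH hJH.symm]
    have hnn : ∀ I ∈ B', 0 ≤ α I * prevision M (ind I) := fun I hI => by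
      by_cases hI0 : α I = 0
      · rw [hI0, zero_mul]
      by_cases hIu : I = Finset.univ
      · rw [hIu, hM0 _ hB.univ_mem hJu.symm, mul_zero]
      · exact mul_nonneg (hα I hI hIu)
          (prevision_dual_nonneg hB.univ_mem hJ hJu hM1 hM0 (hface I hI hI0))
    have := (Finset.sum_eq_zero_iff_of_nonneg hnn).1 hs K hK
    rw [hcJ]
    exact (mul_eq_zero.1 this).resolve_left hαK
  have hrep : (ind K : Fin n → ℝ) = c H • ind H + c Finset.univ • ind Finset.univ := by
    rw [hc]
    exact Finset.sum_eq_add_of_mem H Finset.univ hH hB.univ_mem hHu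
      (fun J hJ hne => by rw [hc0 J hJ hne.1 hne.2, zero_smul])
  have hne : H.Nonempty := by
    by_contra he
    rw [Finset.not_nonempty_iff_eq_empty] at he
    rw [he, prevision_ind, Finset.sum_empty] at hL1
    exact zero_ne_one hL1
  exact eq_of_ind_eq_smul_add (hcH ▸ hLpos) hne hHu hrep ▸ hK

/-- The common face is spanned by the generators of `B` in it. Codimension one means that there are
$n-1$ of them, and all belong to `B'`, so each family has exactly one further member. -/
theorem IsMESC.exists_swap_of_conesAdjacent (hB : IsMESC B) {B' : Finset (Finset (Fin n))}
    (hB' : IsMESC B') (h : ConesAdjacent (cone B) (cone B')) :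
    ∃ G G', AdjacentSwap B G G' ∧ B' = swap B G G' := by
  classical
  set K := B.filter fun H => ind H ∈ cone B ∩ cone B' with hK
  have hX0 : (0 : Fin n → ℝ) ∈ cone B ∩ cone B' := ⟨zero_mem_cone _, zero_mem_cone _⟩
  have hKB : K ⊆ B := Finset.filter_subset _ _
  have hspan : Submodule.span ℝ (cone B ∩ cone B') =
      Submodule.span ℝ (ind '' (K : Set (Finset (Fin n)))) := by
    refine le_antisymm (Submodule.span_le.2 fun x hx => ?_) (Submodule.span_mono ?_)
    · obtain ⟨α, hα, rfl⟩ := exists_sum_of_mem_cone hB.univ_mem hx.1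
      refine Submodule.sum_mem _ fun H hH => ?_
      by_cases h0 : α H = 0
      · rw [h0, zero_smul]; exact Submodule.zero_mem _
      · refine Submodule.smul_mem _ _ (Submodule.subset_span ⟨H, ?_, rfl⟩)
        exact Finset.mem_filter.2
          ⟨hH, ind_mem_of_isExposed hB.univ_mem h.1 hX0 hα hx hH h0⟩
    · rintro _ ⟨H, hH, rfl⟩
      exact (Finset.mem_filter.1 hH).2
  have hcard : K.card + 1 = n := by
    rw [← finrank_span_ind (hB.linearIndep.mono (Finset.coe_subset.2 hKB)), ← hspan]
    exact h.2.2
  have hKB' : K ⊆ B' := fun H hH =>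
    hB.mem_of_common_face hB' h.2.1 (hKB hH) (Finset.mem_filter.1 hH).2
  have huK : Finset.univ ∈ K := Finset.mem_filter.2
    ⟨hB.univ_mem, ind_mem_cone hB.univ_mem, ind_mem_cone hB'.univ_mem⟩
  obtain ⟨G, hG, hGB⟩ := Finset.exists_eq_insert_iff.2 ⟨hKB, hcard.trans hB.card_eq.symm⟩
  obtain ⟨G', hG', hGB'⟩ := Finset.exists_eq_insert_iff.2 ⟨hKB', hcard.trans hB'.card_eq.symm⟩
  have hKe : K = B.erase G := by rw [← hGB, Finset.erase_insert hG]
  have heq : B' = swap B G G' := by rw [swap_eq_insert, ← hKe, hGB']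
  refine ⟨G, G', ⟨hGB ▸ Finset.mem_insert_self _ _, fun hu => hG (hu ▸ huK), fun hm => ?_,
    heq ▸ hB', heq ▸ h⟩, heq⟩
  -- With equal extra members the families coincide, and then the intersection spans the whole
  -- space.
  have hGG : G' = G := by
    rw [← hGB] at hm
    exact (Finset.mem_insert.1 hm).resolve_right hG'
  have hBB : B' = B := by rw [← hGB', hGG, hGB]
  refine finrank_span_lt h.2.2 ?_
  rw [hBB, Set.inter_self, eq_top_iff, ← hB.span_eq_top]
  refine Submodule.span_mono ?_
  rintro _ ⟨H, hH, rfl⟩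
  exact ind_mem_cone hH

/-! ### Distinguishing constraint sets -/

theorem seg_injOn {i k : ℕ} (hi : i ≤ n) (hk : k ≤ n) (h : seg n i = seg n k) : i = k := by
  wlog hlt : i < k generalizing i k
  · rcases Nat.lt_trichotomy i k with h1 | h1 | h1
    exacts [absurd h1 hlt, h1, (this hk hi h.symm h1).symm]
  have : (⟨i, by omega⟩ : Fin n) ∈ seg n k := by rw [mem_seg]; exact hlt
  rw [← h, mem_seg] at this
  exact absurd this (lt_irrefl _)

theorem compl_injOn {i k : ℕ} (hi : i ≤ n) (hk : k ≤ n) (h : (seg n i)ᶜ = (seg n k)ᶜ) : i = k :=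
  seg_injOn hi hk (compl_inj_iff.1 h)

theorem pt_injOn {i k : ℕ} (h1 : 1 ≤ i) (hi : i ≤ n) (h : pt n i = pt n k) : i = k := by
  have : (⟨i - 1, by omega⟩ : Fin n) ∈ pt n i := by rw [mem_pt]; simp; omega
  rw [h, mem_pt] at this
  simp at this; omega

theorem seg_ne_compl' {i k : ℕ} (h1 : 1 ≤ i) (h2 : 1 ≤ k) (hi : i ≤ n) :
    seg n i ≠ (seg n k)ᶜ := fun h => by
  have : (⟨0, by omega⟩ : Fin n) ∈ seg n i := by rw [mem_seg]; exact h1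
  rw [h, Finset.mem_compl, mem_seg] at this
  exact this h2

/-- The bound on `k`, here and in `compl_ne_pt`, excludes the coincidences $A_1=\{x_1\}$ and
$A_{n-1}^c=\{x_n\}$. -/
theorem seg_ne_pt {i k : ℕ} (h1 : 1 ≤ i) (hi : i ≤ n) (h2 : 1 < k) : seg n i ≠ pt n k :=
  fun h => by
    have : (⟨0, by omega⟩ : Fin n) ∈ seg n i := by rw [mem_seg]; exact h1
    rw [h, mem_pt] at this
    simp at this; omega

theorem compl_ne_pt {i k : ℕ} (hi : i < n) (hk : k < n) : (seg n i)ᶜ ≠ pt n k :=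
  fun h => by
    have : (⟨n - 1, by omega⟩ : Fin n) ∈ (seg n i)ᶜ := by
      rw [Finset.mem_compl, mem_seg]; simp; omega
    rw [h, mem_pt] at this
    simp at this; omega

/-! ### The constraint sets on one side of a bump -/

/-- Bumps are nonnegative, so initial segments never qualify; a singleton sees the jump at its
point, and the only downward jump is at $t+1$. -/
theorem eq_of_prevision_bump_neg {s t : ℕ} (hs : 1 ≤ s) (ht : t < n) {H : Finset (Fin n)}
    (hH : IsConstraintSet H) (hneg : prevision (bump s t) (ind H) < 0) :
    (∃ k, s ≤ k ∧ k ≤ t ∧ H = (seg n k)ᶜ) ∨ H = pt n (t + 1) := by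
  rcases hH with ⟨k, h1, h2, rfl⟩ | ⟨k, h1, h2, rfl⟩ | ⟨i, h1, h2, rfl⟩
  · rw [prevision_bump_seg hs h2] at hneg
    exact absurd hneg (bump_nonneg _ _ _).not_gt
  · rw [prevision_bump_compl ht h2.le] at hneg
    by_cases hk : s ≤ k ∧ k ≤ t
    · exact Or.inl ⟨k, hk.1, hk.2, rfl⟩
    · rw [bump, if_neg hk, neg_zero] at hneg
      exact absurd hneg (lt_irrefl _)
  · right
    rw [prevision_pt _ h1 h2] at hneg
    simp only [bump] at hneg
    split_ifs at hneg with h3 h4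
    · norm_num at hneg
    · norm_num at hneg
    · rw [show i = t + 1 by omega]
    · norm_num at hneg

theorem eq_of_prevision_bump_pos {s t : ℕ} (hs : 1 ≤ s) (ht : t < n) {H : Finset (Fin n)}
    (hH : IsConstraintSet H) (hpos : 0 < prevision (bump s t) (ind H)) :
    (∃ k, s ≤ k ∧ k ≤ t ∧ H = seg n k) ∨ H = pt n s := by
  rcases hH with ⟨k, h1, h2, rfl⟩ | ⟨k, h1, h2, rfl⟩ | ⟨i, h1, h2, rfl⟩
  · rw [prevision_bump_seg hs h2] at hpos
    by_cases hk : s ≤ k ∧ k ≤ t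
    · exact Or.inl ⟨k, hk.1, hk.2, rfl⟩
    · rw [bump, if_neg hk] at hpos
      exact absurd hpos (lt_irrefl _)
  · rw [prevision_bump_compl ht h2.le] at hpos
    linarith [bump_nonneg s t k]
  · right
    rw [prevision_pt _ h1 h2] at hpos
    simp only [bump] at hpos
    split_ifs at hpos with h3 h4
    · norm_num at hpos
    · rw [show i = s by omega]
    · norm_num at hpos
    · norm_num at hpos

/-- $A_s^c$ is $A_k^c$ together with the points $x_{s+1},\dots,x_k$, added one at a time. -/
theorem ind_compl_mem_nonnegCone {S : Finset (Finset (Fin n))} {s k : ℕ} (hsk : s ≤ k)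
    (h : ∀ l, s < l → l ≤ k → pt n l ∈ S) (hk : ind (seg n k)ᶜ ∈ nonnegCone S) :
    ind (seg n s)ᶜ ∈ nonnegCone S := by
  induction k, hsk using Nat.le_induction with
  | base => exact hk
  | succ k hsk ih =>
    refine ih (fun l h1 h2 => h l h1 (by omega)) ?_
    have := ind_compl_add_pt (n := n) (k := k + 1) (by omega)
    rw [Nat.add_sub_cancel] at this
    rw [this]
    exact add_mem_nonnegCone hk (ind_mem_nonnegCone (h _ (by omega) le_rfl))

theorem ind_seg_mem_nonnegCone {S : Finset (Finset (Fin n))} {s k : ℕ} (hsk : s ≤ k)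
    (h : ∀ l, s < l → l ≤ k → pt n l ∈ S) (hs : ind (seg n s) ∈ nonnegCone S) :
    ind (seg n k) ∈ nonnegCone S := by
  induction k, hsk using Nat.le_induction with
  | base => exact hs
  | succ k hsk ih =>
    rw [ind_seg_add_pt (by omega), Nat.add_sub_cancel]
    exact add_mem_nonnegCone (ih fun l h1 h2 => h l h1 (by omega))
      (ind_mem_nonnegCone (h _ (by omega) le_rfl))

/-! ### Exchanging a generator -/

/-- After an exchange across the hyperplane of the other generators, only constraint sets that lie
beyond this hyperplane and contain the new generator can violate elementarity. -/
theorem IsMESC.swap_of_elementary (hB : IsMESC B) {G G' : Finset (Fin n)} {F : ℕ → ℝ}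
    (hG : G ∈ B) (hGu : G ≠ Finset.univ) (hG' : IsConstraintSet G')
    (h1 : prevision F (ind G) = 1) (h0 : ∀ H ∈ B, H ≠ G → prevision F (ind H) = 0)
    (hneg : prevision F (ind G') < 0)
    (hel : ∀ K, IsConstraintSet K → K ∉ swap B G G' → prevision F (ind K) < 0 → G' ⊆ K →
      ind K ∉ nonnegCone (swap B G G')) :
    IsMESC (swap B G G') := by
  have hG'B : G' ∉ B := fun hm => by
    by_cases he : G' = G
    · rw [he, h1] at hneg; linarith
    · rw [h0 _ hm he] at hneg; linarith
  refine ⟨fun H hH => ?_, mem_swap_of_ne hB.univ_mem hGu.symm, hB.linearIndepOn_swap h0 hneg.ne,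
    ?_, fun K hK hKs hmem => ?_⟩
  · rcases Finset.mem_insert.1 hH with rfl | hH
    exacts [hG', hB.isConstraintSet _ (Finset.mem_of_mem_erase hH)]
  · rw [swap, Finset.card_insert_of_notMem fun h => hG'B (Finset.mem_of_mem_erase h),
      Finset.card_erase_of_mem hG, hB.card_eq]
    have := hB.pos
    omega
  · obtain ⟨α, hα, hsum⟩ := id hmem
    have hval : prevision F (ind K) = α G' * prevision F (ind G') := by
      rw [hsum, prevision_sum_smul]
      refine Finset.sum_eq_single_of_mem G' mem_swap_self fun H hH hne => ?_
      rcases Finset.mem_insert.1 hH with rfl | hH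
      · exact absurd rfl hne
      · rw [h0 H (Finset.mem_of_mem_erase hH) (Finset.ne_of_mem_erase hH), mul_zero]
    -- Without `G'` the representation of `K` uses old generators only, against elementarity of `B`,
    -- or against $F(G)=1$ when `K` is `G`. With positive weight on `G'`, the set `K` lies beyond
    -- the hyperplane and contains `G'`.
    rcases (hα G' mem_swap_self).eq_or_lt with hz | hpos
    · rw [← hz, zero_mul] at hval
      by_cases hKB : K ∈ B
      · have hKG : K = G := by
          by_contra hne; exact hKs (mem_swap_of_ne hKB hne)
        rw [hKG, h1] at hval
        exact one_ne_zero hval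
      · refine hB.elementary K hK hKB ⟨fun H => if H = G then 0 else α H, fun H hH => ?_, ?_⟩
        · dsimp only
          split_ifs with he
          · exact le_rfl
          · exact hα H (mem_swap_of_ne hH he)
        · rw [hsum, swap_eq_insert,
            Finset.sum_insert fun h => hG'B (Finset.mem_of_mem_erase h), ← hz, zero_smul,
            zero_add, ← Finset.add_sum_erase _ _ hG]
          simp only [if_true, zero_smul, zero_add]
          exact Finset.sum_congr rfl fun H hH => by rw [if_neg (Finset.ne_of_mem_erase hH)]
    · exact hel K hK hKs (hval ▸ mul_neg_of_pos_of_neg hpos hneg)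
        (subset_of_nonneg_sum hα hsum mem_swap_self hpos) hmem

/-- The indicator of `{s, …, t}` vanishes on all members of `B` except `G`, where its value is
`ε`, and the elements after the `s`-th, up to the `t`-th, are singletons of `B`. -/
structure IsBump (B : Finset (Finset (Fin n))) (G : Finset (Fin n)) (s t : ℕ) (ε : ℝ) : Prop where
  one_le : 1 ≤ s
  le : s ≤ t
  lt : t < n
  mem : G ∈ B
  zero : ∀ H ∈ B, H ≠ G → prevision (bump s t) (ind H) = 0
  val : prevision (bump s t) (ind G) = ε
  sing : ∀ l, s < l → l ≤ t → Sing B l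

section
variable {G G' : Finset (Fin n)} {s t : ℕ} {ε : ℝ}

theorem IsBump.ne_of_prevision_eq (h : IsBump B G s t ε) (hε : ε ≠ 0) {H : Finset (Fin n)}
    (hH : prevision (bump s t) (ind H) = 0) : H ≠ G := by
  rintro rfl
  exact hε (h.val.symm.trans hH)

theorem IsBump.ne_univ (h : IsBump B G s t ε) (hε : ε ≠ 0) : G ≠ Finset.univ :=
  (h.ne_of_prevision_eq hε (prevision_bump_univ h.one_le h.lt)).symm

theorem IsBump.pt_mem_swap (h : IsBump B G s t ε) (hε : ε ≠ 0) {l : ℕ} (h1 : s < l)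
    (h2 : l ≤ t) : pt n l ∈ swap B G G' := by
  have := h.lt
  exact mem_swap_of_ne (h.sing l h1 h2).2.2 (h.ne_of_prevision_eq hε
    (prevision_bump_pt (by omega) (by omega) (by omega) (by omega)))

theorem prevision_neg (F : ℕ → ℝ) (h : Fin n → ℝ) : prevision (-F) h = -prevision F h := by
  have := prevision_add_smul (0 : ℕ → ℝ) F (-1) h
  simpa [prevision] using this

/-- For an upward bump, adjacency of an exchange is a matter of sign. -/
theorem IsBump.conesAdjacent_up (hB : IsMESC B) (h : IsBump B G s t 1) (hG' : G' ∉ B)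
    (hB' : IsMESC (swap B G G')) :
    ConesAdjacent (cone B) (cone (swap B G G')) ↔ prevision (bump s t) (ind G') < 0 :=
  hB.conesAdjacent_swap_iff h.mem (h.ne_univ one_ne_zero) hG' hB' h.val h.zero

/-- For a downward bump, adjacency of an exchange is a matter of sign. -/
theorem IsBump.conesAdjacent_down (hB : IsMESC B) (h : IsBump B G s t (-1)) (hG' : G' ∉ B)
    (hB' : IsMESC (swap B G G')) :
    ConesAdjacent (cone B) (cone (swap B G G')) ↔ 0 < prevision (bump s t) (ind G') := by
  rw [hB.conesAdjacent_swap_iff (F := -bump s t) h.mem (h.ne_univ (by norm_num)) hG' hB'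
    (by rw [prevision_neg, h.val, neg_neg])
    (fun H hH hne => by rw [prevision_neg, h.zero H hH hne, neg_zero]), prevision_neg, neg_lt_zero]

theorem IsBump.notMem_of_neg (h : IsBump B G s t 1) (hneg : prevision (bump s t) (ind G') < 0) :
    G' ∉ B := fun hm => by
  by_cases he : G' = G
  · rw [he, h.val] at hneg; linarith
  · rw [h.zero _ hm he] at hneg; exact lt_irrefl _ hneg

theorem IsBump.notMem_of_pos (h : IsBump B G s t (-1))
    (hpos : 0 < prevision (bump s t) (ind G')) : G' ∉ B := fun hm => by
  by_cases he : G' = G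
  · rw [he, h.val] at hpos; linarith
  · rw [h.zero _ hm he] at hpos; exact lt_irrefl _ hpos

theorem IsBump.adjacentSwap_up (hB : IsMESC B) (h : IsBump B G s t 1) (hG' : IsConstraintSet G')
    (hneg : prevision (bump s t) (ind G') < 0)
    (hel : ∀ K, IsConstraintSet K → K ∉ swap B G G' → prevision (bump s t) (ind K) < 0 → G' ⊆ K →
      ind K ∉ nonnegCone (swap B G G')) : AdjacentSwap B G G' := by
  have hu := h.ne_univ one_ne_zero
  have hM := hB.swap_of_elementary h.mem hu hG' h.val h.zero hneg hel
  have hm := h.notMem_of_neg hneg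
  exact ⟨h.mem, hu, hm, hM, (h.conesAdjacent_up hB hm hM).2 hneg⟩

theorem IsBump.adjacentSwap_down (hB : IsMESC B) (h : IsBump B G s t (-1))
    (hG' : IsConstraintSet G') (hpos : 0 < prevision (bump s t) (ind G'))
    (hel : ∀ K, IsConstraintSet K → K ∉ swap B G G' → 0 < prevision (bump s t) (ind K) → G' ⊆ K →
      ind K ∉ nonnegCone (swap B G G')) : AdjacentSwap B G G' := by
  have hu := h.ne_univ (by norm_num)
  have hM := hB.swap_of_elementary (F := -bump s t) h.mem hu hG'
    (by rw [prevision_neg, h.val, neg_neg])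
    (fun H hH hne => by rw [prevision_neg, h.zero H hH hne, neg_zero])
    (by rw [prevision_neg, neg_lt_zero]; exact hpos)
    (fun K hK hKs hKn => hel K hK hKs (by rwa [prevision_neg, neg_lt_zero] at hKn))
  have hm := h.notMem_of_pos hpos
  exact ⟨h.mem, hu, hm, hM, (h.conesAdjacent_down hB hm hM).2 hpos⟩

/-! ### Upward bumps -/

theorem IsBump.prevision_compl_start (h : IsBump B G s t ε) :
    prevision (bump s t) (ind (seg n s)ᶜ) = -1 := by
  rw [prevision_bump_compl h.lt (h.le.trans h.lt.le), bump_of_mem le_rfl h.le]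

theorem IsBump.prevision_seg_end (h : IsBump B G s t ε) :
    prevision (bump s t) (ind (seg n t)) = 1 := by
  rw [prevision_bump_seg h.one_le h.lt.le, bump_of_mem h.le le_rfl]

/-- All candidates beyond the hyperplane are contained in $A_s^c$, so one that contains it is equal
to it and elementarity cannot fail. -/
theorem IsBump.adjacentSwap_compl (hB : IsMESC B) (h : IsBump B G s t 1) :
    AdjacentSwap B G (seg n s)ᶜ := by
  have hs := h.one_le
  have hst := h.le
  have ht := h.lt
  refine h.adjacentSwap_up hB (Or.inr (Or.inl ⟨s, hs, by omega, rfl⟩))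
    (by rw [h.prevision_compl_start]; norm_num) fun K hK hKs hneg hsub => ?_
  refine absurd ?_ hKs
  suffices K = (seg n s)ᶜ from this ▸ mem_swap_self
  have hmem : ∀ x (hx : x < n), s ≤ x → (⟨x, hx⟩ : Fin n) ∈ K := fun x hx hsx =>
    hsub (by rw [Finset.mem_compl, mem_seg]; exact not_lt.2 hsx)
  rcases eq_of_prevision_bump_neg hs ht hK hneg with ⟨k, h1, h2, rfl⟩ | rfl
  · have := hmem s (by omega) le_rfl
    rw [Finset.mem_compl, mem_seg] at this
    rw [show k = s by simp at this; omega]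
  -- A singleton containing both $x_{s+1}$ and $x_n$ is $\{x_n\}$, with $s=n-1$.
  · have h1 := hmem s (by omega) le_rfl
    have h2 := hmem (n - 1) (by omega) (by omega)
    rw [mem_pt] at h1 h2
    simp only at h1 h2
    rw [show t + 1 = n by omega, pt_last, show n - 1 = s by omega]

theorem IsBump.notMem_compl_start (h : IsBump B G s t 1) : (seg n s)ᶜ ∉ B :=
  h.notMem_of_neg (by rw [h.prevision_compl_start]; norm_num)

/-- Elementarity of the new family forces $A_s^c$ into it, and it was not in `B`. This rejects every
exchange that makes $A_s^c$ generated. -/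
theorem IsBump.eq_compl_start (h : IsBump B G s t 1) (hB' : IsMESC (swap B G G'))
    (hmem : ind (seg n s)ᶜ ∈ nonnegCone (swap B G G')) : G' = (seg n s)ᶜ := by
  by_contra hne
  have hst := h.le
  have ht := h.lt
  refine hB'.elementary _ (Or.inr (Or.inl ⟨s, h.one_le, by omega, rfl⟩)) (fun hm => ?_) hmem
  rcases Finset.mem_insert.1 hm with he | hm
  · exact hne he.symm
  · exact h.notMem_compl_start (Finset.mem_of_mem_erase hm)

/-- A candidate $A_k^c$ with $s<k\le t$ would generate $A_s^c$ by means of the singletons inside the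
bump, which are kept. -/
theorem IsBump.eq_of_adjacentSwap_up (hB : IsMESC B) (h : IsBump B G s t 1)
    (hadj : AdjacentSwap B G G') : G' = pt n (t + 1) ∨ G' = (seg n s)ᶜ := by
  obtain ⟨-, -, hm, hM, hC⟩ := hadj
  rcases eq_of_prevision_bump_neg h.one_le h.lt (hM.isConstraintSet _ mem_swap_self)
    ((h.conesAdjacent_up hB hm hM).1 hC) with ⟨k, h1, h2, rfl⟩ | rfl
  · exact Or.inr (h.eq_compl_start hM (ind_compl_mem_nonnegCone h1
      (fun l h3 h4 => h.pt_mem_swap one_ne_zero h3 (by omega))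
      (ind_mem_nonnegCone mem_swap_self)))
  · exact Or.inl rfl

/-- Here $\{x_{t+1}\}$ is rejected: with the singletons of the bump and $A_{t+1}^c$, which is empty
if $t+1=n$, it generates $A_s^c$. -/
theorem IsBump.adjacentSwap_iff_of_neg_end (hB : IsMESC B) (h : IsBump B G s t 1)
    (hend : Neg B (t + 1) ∨ t + 1 = n) : AdjacentSwap B G G' ↔ G' = (seg n s)ᶜ := by
  refine ⟨fun hadj => ?_, fun he => he ▸ h.adjacentSwap_compl hB⟩
  have ht := h.lt
  rcases h.eq_of_adjacentSwap_up hB hadj with rfl | he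
  · refine h.eq_compl_start hadj.2.2.2.1 (ind_compl_mem_nonnegCone (k := t + 1)
      (by have := h.le; omega) (fun l h3 h4 => ?_) ?_)
    · rcases h4.eq_or_lt with rfl | h4
      · exact mem_swap_self
      · exact h.pt_mem_swap one_ne_zero h3 (by omega)
    · rcases hend with hneg | hn
      · refine ind_mem_nonnegCone (mem_swap_of_ne hneg.2.2 (h.ne_of_prevision_eq one_ne_zero ?_))
        rw [prevision_bump_compl h.lt ht, bump_of_gt (by omega), neg_zero]
      · have : (ind (seg n (t + 1))ᶜ : Fin n → ℝ) = 0 := by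
          rw [hn, seg_self]; ext x; simp [ind]
        rw [this]; exact zero_mem_nonnegCone _
  · exact he

theorem prevision_nonneg_of_mem_nonnegCone {S : Finset (Finset (Fin n))} {F : ℕ → ℝ}
    (hF : ∀ H ∈ S, 0 ≤ prevision F (ind H)) {x : Fin n → ℝ} (hx : x ∈ nonnegCone S) :
    0 ≤ prevision F x := by
  obtain ⟨α, hα, rfl⟩ := hx
  rw [prevision_sum_smul]
  exact Finset.sum_nonneg fun H hH => mul_nonneg (hα H hH) (hF H hH)

/-- Here $\{x_{t+1}\}$ is admitted: extending the bump across `q`, up to the missing index of the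
following pair, gives a functional that is nonnegative on the new family and negative on every
$A_k^c$ with $s\le k\le t$. The assumption $q<n$ provides the following pair. -/
theorem IsBump.adjacentSwap_iff_of_pos_end (hB : IsMESC B) (h : IsBump B G s t 1) {p q : ℕ}
    (hpq : Consec B p q) (hq : Pos B q) (hqn : q < n) (hj : Missing B p q (t + 1)) :
    AdjacentSwap B G G' ↔ G' = pt n (t + 1) ∨ G' = (seg n s)ᶜ := by
  refine ⟨h.eq_of_adjacentSwap_up hB, ?_⟩
  rintro (rfl | rfl)
  swap
  · exact h.adjacentSwap_compl hB
  have hs := h.one_le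
  have hst := h.le
  have ht := h.lt
  obtain ⟨r, hqr⟩ := hB.exists_consec_right (Or.inl hq) hqn
  obtain ⟨j, hqj⟩ := hB.exists_missing hqr
  have h1 := hj.1
  have h2 := hj.2.1
  have h3 := hqj.1
  have h4 := hqj.2.1
  have h5 := hqr.le
  refine h.adjacentSwap_up hB (Or.inr (Or.inr ⟨t + 1, by omega, ht, rfl⟩))
    (by rw [prevision_bump_pt_right hst ht]; norm_num) fun K hK hKs hneg _ hmem => ?_
  rcases eq_of_prevision_bump_neg hs ht hK hneg with ⟨k, hk1, hk2, rfl⟩ | rfl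
  swap
  · exact hKs mem_swap_self
  have hnn := prevision_nonneg_of_mem_nonnegCone (F := bump s (j - 1)) (fun H hH => ?_) hmem
  · rw [prevision_bump_compl (by omega) (by omega), bump_of_mem hk1 (by omega)] at hnn
    linarith
  rcases Finset.mem_insert.1 hH with rfl | hH
  · rw [prevision_bump_pt (by omega) ht (by omega) (by omega)]
  have hz := h.zero H (Finset.mem_of_mem_erase hH) (Finset.ne_of_mem_erase hH)
  rcases hB.mem_cases (Finset.mem_of_mem_erase hH) with
    ⟨m, hm1, hm2, hp, rfl⟩ | ⟨m, hm, rfl⟩ | ⟨i, hi, rfl⟩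
  · rw [prevision_bump_seg hs hm2]; exact bump_nonneg _ _ _
  -- No complement is seen: up to `t` because the original bump vanishes on `H`, beyond `t` because
  -- `q` is the only chain index there and has sign $+$.
  · have hmn := hm.2.1
    rw [prevision_bump_compl (by omega) hmn.le, bump, if_neg, neg_zero]
    rintro ⟨hm1, hm2⟩
    rcases Nat.lt_or_ge t m with htm | htm
    · rcases Nat.lt_trichotomy m q with hlt | rfl | hlt
      · exact hpq.2.2.2 m (by omega) hlt (Or.inr hm)
      · exact hB.not_pos_and_neg hq hm
      · exact hqr.2.2.2 m hlt (by omega) (Or.inr hm)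
    · rw [prevision_bump_compl ht hmn.le, bump_of_mem hm1 htm] at hz
      norm_num at hz
  · have hi1 := hi.1
    rw [prevision_bump_pt (by omega) hi.2.1.le]
    · rintro rfl
      rw [prevision_bump_pt_left hs hst ht] at hz
      exact one_ne_zero hz
    · rw [show j - 1 + 1 = j by omega]
      rintro rfl
      exact hqj.2.2 hi

/-! ### Downward bumps -/

/-- Reversing the order of the points interchanges segments with complements and upward with
downward bumps. Now all candidates lie in $A_t$. -/
theorem IsBump.adjacentSwap_seg (hB : IsMESC B) (h : IsBump B G s t (-1)) :
    AdjacentSwap B G (seg n t) := by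
  have hs := h.one_le
  have hst := h.le
  have ht := h.lt
  refine h.adjacentSwap_down hB (Or.inl ⟨t, by omega, by omega, rfl⟩)
    (by rw [h.prevision_seg_end]; norm_num) fun K hK hKs hpos hsub => ?_
  refine absurd ?_ hKs
  suffices K = seg n t from this ▸ mem_swap_self
  have hmem : ∀ x (hx : x < t), (⟨x, by omega⟩ : Fin n) ∈ K := fun x hx =>
    hsub (by rw [mem_seg]; exact hx)
  rcases eq_of_prevision_bump_pos hs ht hK hpos with ⟨k, h1, h2, rfl⟩ | rfl
  · have := hmem (t - 1) (by omega)
    rw [mem_seg] at this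
    rw [show k = t by simp at this; omega]
  · have h1 := hmem 0 (by omega)
    have h2 := hmem (t - 1) (by omega)
    rw [mem_pt] at h1 h2
    simp only at h1 h2
    rw [show s = 1 by omega, pt_one, show t = 1 by omega]

theorem IsBump.notMem_seg_end (h : IsBump B G s t (-1)) : seg n t ∉ B :=
  h.notMem_of_pos (by rw [h.prevision_seg_end]; norm_num)

theorem IsBump.eq_seg_end (h : IsBump B G s t (-1)) (hB' : IsMESC (swap B G G'))
    (hmem : ind (seg n t) ∈ nonnegCone (swap B G G')) : G' = seg n t := by
  by_contra hne
  have hs := h.one_le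
  have hst := h.le
  have ht := h.lt
  refine hB'.elementary _ (Or.inl ⟨t, by omega, by omega, rfl⟩) (fun hm => ?_) hmem
  rcases Finset.mem_insert.1 hm with he | hm
  · exact hne he.symm
  · exact h.notMem_seg_end (Finset.mem_of_mem_erase hm)

theorem IsBump.eq_of_adjacentSwap_down (hB : IsMESC B) (h : IsBump B G s t (-1))
    (hadj : AdjacentSwap B G G') : G' = seg n t ∨ G' = pt n s := by
  obtain ⟨-, -, hm, hM, hC⟩ := hadj
  rcases eq_of_prevision_bump_pos h.one_le h.lt (hM.isConstraintSet _ mem_swap_self)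
    ((h.conesAdjacent_down hB hm hM).1 hC) with ⟨k, h1, h2, rfl⟩ | rfl
  · exact Or.inl (h.eq_seg_end hM (ind_seg_mem_nonnegCone h2
      (fun l h3 h4 => h.pt_mem_swap (by norm_num) (by omega) h4)
      (ind_mem_nonnegCone mem_swap_self)))
  · exact Or.inr rfl

/-- $\{x_s\}$ is rejected because with $A_{s-1}$, empty if $s=1$, and the singletons of the bump it
generates $A_t$. -/
theorem IsBump.adjacentSwap_iff_of_pos_start (hB : IsMESC B) (h : IsBump B G s t (-1))
    (hstart : Pos B (s - 1)) : AdjacentSwap B G G' ↔ G' = seg n t := by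
  refine ⟨fun hadj => ?_, fun he => he ▸ h.adjacentSwap_seg hB⟩
  have hs := h.one_le
  have hst := h.le
  have ht := h.lt
  rcases h.eq_of_adjacentSwap_down hB hadj with he | rfl
  · exact he
  · refine h.eq_seg_end hadj.2.2.2.1 (ind_seg_mem_nonnegCone (s := s - 1)
      (by omega) (fun l h3 h4 => ?_) ?_)
    · rcases (show s ≤ l by omega).eq_or_lt with rfl | h5
      · exact mem_swap_self
      · exact h.pt_mem_swap (by norm_num) h5 h4
    · rcases Nat.eq_zero_or_pos (s - 1) with h0 | h0
      · have : (ind (seg n (s - 1)) : Fin n → ℝ) = 0 := by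
          rw [h0]; ext x; simp [ind, mem_seg]
        rw [this]; exact zero_mem_nonnegCone _
      · refine ind_mem_nonnegCone (mem_swap_of_ne (hstart.mem h0)
          (h.ne_of_prevision_eq (by norm_num) ?_))
        rw [prevision_bump_seg hs (by omega), bump_of_lt (by omega)]

/-- The certificate for $\{x_s\}$ is the negative of the bump extended to the left, down to the
missing index of the preceding pair. That pair exists because a chain index of sign $-$ is at least
$1$. -/
theorem IsBump.adjacentSwap_iff_of_neg_start (hB : IsMESC B) (h : IsBump B G s t (-1))
    {p q : ℕ} (hpq : Consec B p q) (hp : Neg B p) (hj : Missing B p q s) :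
    AdjacentSwap B G G' ↔ G' = seg n t ∨ G' = pt n s := by
  refine ⟨h.eq_of_adjacentSwap_down hB, ?_⟩
  rintro (rfl | rfl)
  · exact h.adjacentSwap_seg hB
  have hs := h.one_le
  have hst := h.le
  have ht := h.lt
  obtain ⟨o, hop⟩ := hB.exists_consec_left (Or.inr hp) hp.1
  obtain ⟨j, hoj⟩ := hB.exists_missing hop
  have h1 := hj.1
  have h2 := hj.2.1
  have h3 := hoj.1
  have h4 := hoj.2.1
  refine h.adjacentSwap_down hB (Or.inr (Or.inr ⟨s, hs, by omega, rfl⟩))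
    (by rw [prevision_bump_pt_left hs hst ht]; norm_num) fun K hK hKs hpos _ hmem => ?_
  rcases eq_of_prevision_bump_pos hs ht hK hpos with ⟨k, hk1, hk2, rfl⟩ | rfl
  swap
  · exact hKs mem_swap_self
  have hnn := prevision_nonneg_of_mem_nonnegCone (F := -bump j t) (fun H hH => ?_) hmem
  · rw [prevision_neg, prevision_bump_seg (by omega) (by omega),
      bump_of_mem (by omega) hk2] at hnn
    linarith
  rw [prevision_neg]
  rcases Finset.mem_insert.1 hH with rfl | hH
  · rw [prevision_bump_pt hs (by omega) (by omega) (by omega), neg_zero]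
  have hz := h.zero H (Finset.mem_of_mem_erase hH) (Finset.ne_of_mem_erase hH)
  rcases hB.mem_cases (Finset.mem_of_mem_erase hH) with
    ⟨m, hm1, hm2, hm, rfl⟩ | ⟨m, hm, rfl⟩ | ⟨i, hi, rfl⟩
  · rw [prevision_bump_seg (by omega) hm2, bump, if_neg, neg_zero]
    rintro ⟨hm1, hm3⟩
    rcases Nat.lt_or_ge m s with hms | hms
    · rcases Nat.lt_trichotomy m p with hlt | rfl | hlt
      · exact hop.2.2.2 m (by omega) hlt (Or.inl hm)
      · exact hB.not_pos_and_neg hm hp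
      · exact hpq.2.2.2 m hlt (by omega) (Or.inl hm)
    · rw [prevision_bump_seg hs hm2, bump_of_mem hms hm3] at hz
      exact one_ne_zero hz
  · rw [prevision_bump_compl ht hm.2.1.le, neg_neg]; exact bump_nonneg _ _ _
  · have hi1 := hi.1
    rw [prevision_bump_pt (by omega) hi.2.1.le, neg_zero]
    · rintro rfl
      exact hoj.2.2 hi
    · rintro rfl
      rw [prevision_bump_pt_right hst ht] at hz
      norm_num at hz

end

/-! ### The bumps of the generators -/

section
variable {a b c i j j' : ℕ}

/-- The bump jumps up at `i`, which only $\{x_i\}$ sees, and down at the missing index, which no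
singleton sees; there is no chain member in between. -/
theorem IsMESC.isBump_pt_of_lt (hB : IsMESC B) (h : Consec B a b) (hj : Missing B a b j)
    (hai : a < i) (hij : i < j) (hi : Sing B i) : IsBump B (pt n i) i (j - 1) 1 := by
  have hb := h.le
  have hjb := hj.2.1
  have hi1 := hi.1
  refine ⟨by omega, by omega, by omega, hi.2.2, fun H hH hne => ?_, ?_, fun l h1 h2 => ?_⟩
  · refine hB.prevision_bump_eq_zero (by omega) (by omega) hH ?_ ?_ (fun _ => hne) ?_
    · exact fun k h1 h2 hk => absurd (Or.inl hk) (h.2.2.2 k (by omega) (by omega))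
    · exact fun k h1 h2 hk => absurd (Or.inr hk) (h.2.2.2 k (by omega) (by omega))
    · rw [show j - 1 + 1 = j by omega]
      exact fun hs => absurd hs hj.2.2
  · exact prevision_bump_pt_left (by omega) (by omega) (by omega)
  · exact hB.sing_of_ne_missing h hj (by omega) (by omega) (by omega)

theorem IsMESC.isBump_pt_of_gt (hB : IsMESC B) (h : Consec B a b) (hj : Missing B a b j)
    (hji : j < i) (hib : i ≤ b) (hi : Sing B i) : IsBump B (pt n i) j (i - 1) (-1) := by
  have hb := h.le
  have haj := hj.1
  have hi1 := hi.1
  have hin := hi.2.1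
  refine ⟨by omega, by omega, by omega, hi.2.2, fun H hH hne => ?_, ?_, fun l h1 h2 => ?_⟩
  · refine hB.prevision_bump_eq_zero (by omega) (by omega) hH ?_ ?_ ?_ (fun _ => ?_)
    · exact fun k h1 h2 hk => absurd (Or.inl hk) (h.2.2.2 k (by omega) (by omega))
    · exact fun k h1 h2 hk => absurd (Or.inr hk) (h.2.2.2 k (by omega) (by omega))
    · exact fun hs => absurd hs hj.2.2
    · rw [show i - 1 + 1 = i by omega]
      exact hne
  · have := prevision_bump_pt_right (n := n) (s := j) (t := i - 1) (by omega) (by omega)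
    rwa [show i - 1 + 1 = i by omega] at this
  · exact hB.sing_of_ne_missing h hj (by omega) (by omega) (by omega)

theorem IsMESC.sing_of_between (hB : IsMESC B) (h : Consec B a b) (h' : Consec B b c)
    (hj : Missing B a b j) (hj' : Missing B b c j') {l : ℕ} (h1 : j < l) (h2 : l < j') :
    Sing B l := by
  have haj := hj.1
  have hjc := hj'.2.1
  rcases Nat.lt_or_ge b l with hl | hl
  · exact hB.sing_of_ne_missing h' hj' hl (by omega) (by omega)
  · exact hB.sing_of_ne_missing h hj (by omega) hl (by omega)

theorem Consec.eq_of_chain_between (h : Consec B a b) (h' : Consec B b c) {k : ℕ} (h1 : a < k)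
    (h2 : k < c) (hk : Pos B k ∨ Neg B k) : k = b := by
  rcases Nat.lt_trichotomy k b with hl | hl | hl
  exacts [absurd hk (h.2.2.2 k h1 hl), hl, absurd hk (h'.2.2.2 k hl h2)]

/-- Both jumps sit at missing indices, and `b` is the only chain index in the interval. -/
theorem IsMESC.isBump_seg (hB : IsMESC B) (h : Consec B a b) (h' : Consec B b c)
    (hb : Pos B b) (hj : Missing B a b j) (hj' : Missing B b c j') :
    IsBump B (seg n b) j (j' - 1) 1 := by
  have hc := h'.le
  obtain ⟨h1, h2, h3⟩ := hj
  obtain ⟨h4, h5, h6⟩ := hj'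
  refine ⟨by omega, by omega, by omega, hb.mem (by omega), fun H hH hne => ?_, ?_,
    fun l h7 h8 => hB.sing_of_between h h' ⟨h1, h2, h3⟩ ⟨h4, h5, h6⟩ h7 (by omega)⟩
  · refine hB.prevision_bump_eq_zero (by omega) (by omega) hH ?_ ?_ (fun hs => absurd hs h3) ?_
    · intro k hk1 hk2 hk
      rw [h.eq_of_chain_between h' (by omega) (by omega) (Or.inl hk)]
      exact hne
    · intro k hk1 hk2 hk
      have := h.eq_of_chain_between h' (by omega) (by omega) (Or.inr hk)
      exact (hB.not_pos_and_neg hb (this ▸ hk)).elim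
    · rw [show j' - 1 + 1 = j' by omega]
      exact fun hs => absurd hs h6
  · rw [prevision_bump_seg (by omega) (by omega), bump_of_mem h2 (by omega)]

theorem IsMESC.isBump_compl (hB : IsMESC B) (h : Consec B a b) (h' : Consec B b c)
    (hb : Neg B b) (hj : Missing B a b j) (hj' : Missing B b c j') :
    IsBump B (seg n b)ᶜ j (j' - 1) (-1) := by
  have hc := h'.le
  obtain ⟨h1, h2, h3⟩ := hj
  obtain ⟨h4, h5, h6⟩ := hj'
  refine ⟨by omega, by omega, by omega, hb.2.2, fun H hH hne => ?_, ?_,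
    fun l h7 h8 => hB.sing_of_between h h' ⟨h1, h2, h3⟩ ⟨h4, h5, h6⟩ h7 (by omega)⟩
  · refine hB.prevision_bump_eq_zero (by omega) (by omega) hH ?_ ?_ (fun hs => absurd hs h3) ?_
    · intro k hk1 hk2 hk
      have := h.eq_of_chain_between h' (by omega) (by omega) (Or.inl hk)
      exact (hB.not_pos_and_neg (this ▸ hk) hb).elim
    · intro k hk1 hk2 hk
      rw [h.eq_of_chain_between h' (by omega) (by omega) (Or.inr hk)]
      exact hne
    · rw [show j' - 1 + 1 = j' by omega]
      exact fun hs => absurd hs h6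
  · rw [prevision_bump_compl (by omega) (by omega), bump_of_mem h2 (by omega)]

end

/-! ### Extreme distributions -/

/-- The constraint of the set `H` holds with equality at `F`. -/
structure TightAt (lo up F : ℕ → ℝ) (H : Finset (Fin n)) : Prop where
  seg : ∀ i, 1 ≤ i → i ≤ n → H = seg n i → F i = lo i
  compl : ∀ i, 1 ≤ i → i < n → H = (PBox.seg n i)ᶜ → F i = up i
  pt : ∀ i, 1 < i → i < n → H = pt n i → F i = F (i - 1)

section
variable {lo up F F' : ℕ → ℝ} {G G' H : Finset (Fin n)}

theorem tightAt_seg_iff {k : ℕ} (h1 : 1 ≤ k) (hk : k < n) :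
    TightAt lo up F (seg n k) ↔ F k = lo k := by
  refine ⟨fun h => h.seg k h1 hk.le rfl, fun h => ⟨fun i _ hi he => ?_, fun i h3 hi he => ?_,
    fun i h3 hi he => ?_⟩⟩
  · rw [← seg_injOn hk.le hi he]; exact h
  · exact absurd he (seg_ne_compl' h1 h3 hk.le)
  · exact absurd he (seg_ne_pt h1 hk.le h3)

theorem tightAt_compl_iff {k : ℕ} (h1 : 1 ≤ k) (hk : k < n) :
    TightAt lo up F (seg n k)ᶜ ↔ F k = up k := by
  refine ⟨fun h => h.compl k h1 hk rfl, fun h => ⟨fun i h3 hi he => ?_, fun i h3 hi he => ?_,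
    fun i h3 hi he => ?_⟩⟩
  · exact absurd he.symm (seg_ne_compl' h3 h1 hi)
  · rw [← compl_injOn hk.le hi.le he]; exact h
  · exact absurd he (compl_ne_pt hk hi)

theorem tightAt_pt_iff {k : ℕ} (h1 : 1 < k) (hk : k < n) :
    TightAt lo up F (pt n k) ↔ F k = F (k - 1) := by
  refine ⟨fun h => h.pt k h1 hk rfl, fun h => ⟨fun i h3 hi he => ?_, fun i h3 hi he => ?_,
    fun i h3 hi he => ?_⟩⟩
  · exact absurd he.symm (seg_ne_pt h3 hi h1)
  · exact absurd he.symm (compl_ne_pt hi hk)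
  · rw [← pt_injOn h1.le hk.le he]; exact h

/-- Tightness depends only on the prevision of the set. -/
theorem TightAt.congr (h : TightAt lo up F H) (h0 : F' 0 = F 0) (hn : F' n = F n)
    (hP : prevision F' (ind H) = prevision F (ind H)) : TightAt lo up F' H := by
  refine ⟨fun i h1 h2 he => ?_, fun i h1 h2 he => ?_, fun i h1 h2 he => ?_⟩
  · rw [he, prevision_seg F h2, prevision_seg F' h2] at hP
    rw [← h.seg i h1 h2 he]; linarith
  · rw [he, prevision_compl F h2.le, prevision_compl F' h2.le] at hP
    rw [← h.compl i h1 h2 he]; linarith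
  · rw [he, prevision_pt F h1.le h2.le, prevision_pt F' h1.le h2.le, h.pt i h1 h2 he] at hP
    linarith

/-- Previsions are bounded below at the generators by the values of a tight distribution. -/
theorem IsMESC.prevision_le_of_tightAt (hB : IsMESC B) (hF : IsDist n F)
    (hF' : F' ∈ credalSet n lo up) (hH : H ∈ B) (h : TightAt lo up F H) :
    prevision F (ind H) ≤ prevision F' (ind H) := by
  obtain ⟨⟨hm, h0, h1⟩, hlo, hup⟩ := hF'
  rcases hB.mem_cases hH with ⟨k, hk1, hk2, -, rfl⟩ | ⟨k, hk, rfl⟩ | ⟨i, hi, rfl⟩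
  · rw [prevision_seg F hk2, prevision_seg F' hk2, hF.2.1, h0, h.seg k hk1 hk2 rfl]
    linarith [hlo k]
  · rw [prevision_compl F hk.2.1.le, prevision_compl F' hk.2.1.le, hF.2.2 n le_rfl, h1 n le_rfl,
      h.compl k hk.1 hk.2.1 rfl]
    linarith [hup k]
  · rw [prevision_pt F hi.1.le hi.2.1.le, prevision_pt F' hi.1.le hi.2.1.le,
      h.pt i hi.1 hi.2.1 rfl, sub_self, sub_nonneg]
    exact hm (Nat.sub_le _ _)

theorem IsMESC.prevision_eq_of_tightAt (hB : IsMESC B) (hF : F ∈ credalSet n lo up)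
    (hF' : F' ∈ credalSet n lo up) (hH : H ∈ B) (h : TightAt lo up F H)
    (h' : TightAt lo up F' H) : prevision F (ind H) = prevision F' (ind H) :=
  le_antisymm (hB.prevision_le_of_tightAt hF.1 hF' hH h)
    (hB.prevision_le_of_tightAt hF'.1 hF hH h')

theorem IsMESC.dist_ext (hB : IsMESC B) (hF : IsDist n F) (hF' : IsDist n F')
    (h : ∀ H ∈ B, prevision F (ind H) = prevision F' (ind H)) : F = F' := by
  funext k
  rcases Nat.lt_or_ge n k with hk | hk
  · rw [hF.2.2 k hk.le, hF'.2.2 k hk.le]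
  · have := hB.prevision_ext h (ind (seg n k))
    rw [prevision_seg F hk, prevision_seg F' hk, hF.2.1, hF'.2.1] at this
    linarith

/-- For a generator family, the extreme distribution is the one at which all its constraints
are tight. -/
theorem IsMESC.isExtremeDist_iff (hB : IsMESC B) :
    IsExtremeDist lo up B F ↔ F ∈ credalSet n lo up ∧ ∀ H ∈ B, TightAt lo up F H := by
  constructor
  · intro h
    have hF := h.extreme.1
    obtain ⟨⟨hm, h0, h1⟩, hlo, hup⟩ := id hF
    refine ⟨hF, fun H hH => ⟨fun i h2 h3 he => ?_, fun i h2 h3 he => ?_, fun i h2 h3 he => ?_⟩⟩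
    · have := h.tight_seg i h2 h3 (he ▸ hH)
      rw [prevision_seg F h3, h0] at this
      linarith
    · have := h.tight_compl i h2 h3 (he ▸ hH)
      rw [prevision_compl F h3.le, h1 n le_rfl] at this
      linarith
    · have := h.tight_pt i h2 h3 (he ▸ hH)
      rw [prevision_pt F h2.le h3.le] at this
      linarith
  · rintro ⟨hF, ht⟩
    have hF0 := hF.1.2.1
    have hF1 := hF.1.2.2
    refine ⟨mem_extremePoints_iff_left.2 ⟨hF, fun x hx y hy hxy => ?_⟩, fun h hh H hH => ?_,
      fun i h1 h2 hm => ?_, fun i h1 h2 hm => ?_, fun i h1 h2 hm => ?_⟩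
    · obtain ⟨u, v, hu, hv, huv, he⟩ := hxy
      refine hB.dist_ext hx.1 hF.1 fun H hH => ?_
      have e1 := hB.prevision_le_of_tightAt hF.1 hx hH (ht H hH)
      have e2 := hB.prevision_le_of_tightAt hF.1 hy hH (ht H hH)
      have e3 : prevision F (ind H) = u * prevision x (ind H) + v * prevision y (ind H) := by
        have h0 := prevision_add_smul (0 : ℕ → ℝ) x u (ind H)
        rw [zero_add] at h0
        have hz : prevision (0 : ℕ → ℝ) (ind H) = 0 := by simp [prevision]
        rw [← he, prevision_add_smul, h0, hz, zero_add]
      -- At each generator `F` attains the minimum and is a proper average of `x` and `y`, so `x`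
      -- attains it too; the generators determine the distribution.
      have e4 := mul_nonneg hv.le (sub_nonneg.2 e2)
      have e5 : (u + v) * prevision F (ind H) = prevision F (ind H) := by rw [huv, one_mul]
      refine le_antisymm (le_of_mul_le_mul_left ?_ hu) e1
      linarith
    · obtain ⟨α, hα, rfl⟩ := exists_sum_of_mem_cone hB.univ_mem hh
      rw [prevision_sum_smul, prevision_sum_smul]
      refine Finset.sum_le_sum fun K hK => ?_
      -- The coefficient of $\Omega$ may be negative, but its probability is always $1$.
      by_cases hKu : K = Finset.univ
      · rw [hKu, prevision_univ, prevision_univ, hF0, hF1 n le_rfl, hH.1.2.1, hH.1.2.2 n le_rfl]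
      · exact mul_le_mul_of_nonneg_left (hB.prevision_le_of_tightAt hF.1 hH hK (ht K hK))
          (hα K hK hKu)
    · rw [prevision_seg F h2, hF0, (ht _ hm).seg i h1 h2 rfl, sub_zero]
    · rw [prevision_compl F h2.le, hF1 n le_rfl, (ht _ hm).compl i h1 h2 rfl]
    · rw [prevision_pt F h1.le h2.le, (ht _ hm).pt i h1 h2 rfl, sub_self]

/-! ### Values of an extreme distribution -/

theorem IsExtremeDist.eq_lo (h : IsExtremeDist lo up B F) (hp : IsPBox n lo up) {k : ℕ}
    (hk : Pos B k) : F k = lo k := by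
  have hF := h.extreme.1.1
  rcases Nat.eq_zero_or_pos k with rfl | hk0
  · rw [hF.2.1, hp.1.2.1]
  · have := h.tight_seg k hk0 hk.le (hk.mem hk0)
    rw [prevision_seg F hk.le, hF.2.1] at this
    linarith

theorem IsExtremeDist.eq_up (h : IsExtremeDist lo up B F) {k : ℕ} (hk : Neg B k) :
    F k = up k := by
  have hF := h.extreme.1.1
  have := h.tight_compl k hk.1 hk.2.1 hk.2.2
  rw [prevision_compl F hk.2.1.le, hF.2.2 n le_rfl] at this
  linarith

theorem IsExtremeDist.eq_pred (h : IsExtremeDist lo up B F) {i : ℕ} (hi : Sing B i) :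
    F i = F (i - 1) := by
  have := h.tight_pt i hi.1 hi.2.1 hi.2.2
  rw [prevision_pt F hi.1.le hi.2.1.le] at this
  linarith

theorem IsExtremeDist.eq_of_sing (h : IsExtremeDist lo up B F) {s k : ℕ} (hsk : s ≤ k)
    (hs : ∀ l, s < l → l ≤ k → Sing B l) : F k = F s := by
  induction k, hsk using Nat.le_induction with
  | base => rfl
  | succ k hsk ih =>
    rw [h.eq_pred (hs (k + 1) (by omega) le_rfl), Nat.add_sub_cancel]
    exact ih fun l h1 h2 => hs l h1 (by omega)

/-- Singletons make `F` flat, so within a pair it can jump only at the missing index. With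
`eq_right` this gives the explicit formulas. -/
theorem IsExtremeDist.eq_left (hB : IsMESC B) (h : IsExtremeDist lo up B F) {a b j k : ℕ}
    (hab : Consec B a b) (hj : Missing B a b j) (h1 : a ≤ k) (h2 : k < j) : F k = F a :=
  h.eq_of_sing h1 fun l h3 h4 =>
    hB.sing_of_ne_missing hab hj h3 (by have := hj.2.1; omega) (by omega)

theorem IsExtremeDist.eq_right (hB : IsMESC B) (h : IsExtremeDist lo up B F) {a b j k : ℕ}
    (hab : Consec B a b) (hj : Missing B a b j) (h1 : j ≤ k) (h2 : k ≤ b) : F k = F b :=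
  (h.eq_of_sing h2 fun l h3 h4 =>
    hB.sing_of_ne_missing hab hj (by have := hj.1; omega) h4 (by omega)).symm

/-! ### The extreme distribution after an exchange -/

variable {s t : ℕ} {ε v : ℝ}

theorem patch_of_mem {k : ℕ} (h1 : s ≤ k) (h2 : k ≤ t) : patch F s t v k = v := by
  simp [patch, h1, h2]

theorem patch_of_lt {k : ℕ} (h : k < s) : patch F s t v k = F k := by
  simp only [patch]; rw [if_neg]; omega

theorem patch_of_gt {k : ℕ} (h : t < k) : patch F s t v k = F k := by
  simp only [patch]; rw [if_neg]; omega

theorem IsBump.eq_start (h : IsBump B G s t ε) (hF : IsExtremeDist lo up B F) {k : ℕ}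
    (h1 : s ≤ k) (h2 : k ≤ t) : F k = F s :=
  hF.eq_of_sing h1 fun l h3 h4 => h.sing l h3 (by omega)

/-- The singletons inside the bump make `F` constant there, so patching is a translation along the
bump. -/
theorem IsBump.patch_eq (h : IsBump B G s t ε) (hF : IsExtremeDist lo up B F) :
    patch F s t v = F + (v - F s) • bump s t := by
  funext k
  simp only [patch, bump, Pi.add_apply, Pi.smul_apply, smul_eq_mul]
  split_ifs with hk
  · rw [h.eq_start hF hk.1 hk.2]; ring
  · ring

/-- The other constraints are tight exactly on the line spanned by the bump. -/
theorem IsBump.tightAt_iff (hB : IsMESC B) (h : IsBump B G s t ε) (hε : ε ≠ 0)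
    (hF : IsExtremeDist lo up B F) (hF' : F' ∈ credalSet n lo up) :
    (∀ H ∈ B, H ≠ G → TightAt lo up F' H) ↔ ∃ w, F' = patch F s t w := by
  obtain ⟨hFc, hFt⟩ := hB.isExtremeDist_iff.1 hF
  have hs := h.one_le
  have ht := h.lt
  constructor
  · intro hT
    refine ⟨F' s, ?_⟩
    -- The multiple of the bump that also matches `F'` at `G`; the two then agree on a basis.
    set c := (prevision F' (ind G) - prevision F (ind G)) / ε with hc
    have hann : ∀ H ∈ B, prevision (F + c • bump s t) (ind H) = prevision F' (ind H) := by
      intro H hH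
      rw [prevision_add_smul]
      by_cases hHG : H = G
      · rw [hHG, h.val, hc]; field_simp; ring
      · rw [h.zero H hH hHG, mul_zero, add_zero]
        exact hB.prevision_eq_of_tightAt hFc hF' hH (hFt H hH) (hT H hH hHG)
    have hval : ∀ k, k ≤ n → F' k = F k + c * bump s t k := by
      intro k hk
      have := hB.prevision_ext hann (ind (seg n k))
      rw [prevision_add_smul, prevision_bump_seg hs hk, prevision_seg F hk, prevision_seg F' hk,
        hFc.1.2.1, hF'.1.2.1] at this
      linarith
    have hcs := hval s (by have := h.le; omega)
    rw [bump_of_mem le_rfl h.le, mul_one] at hcs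
    rw [h.patch_eq hF]
    funext k
    simp only [Pi.add_apply, Pi.smul_apply, smul_eq_mul]
    rcases Nat.lt_or_ge n k with hk | hk
    · rw [hF'.1.2.2 k hk.le, hFc.1.2.2 k hk.le, bump_of_gt (by omega), mul_zero, add_zero]
    · rw [hval k hk, hcs]; ring
  · rintro ⟨w, rfl⟩ H hH hne
    refine (hFt H hH).congr (patch_of_lt (by omega)) (patch_of_gt ht) ?_
    rw [h.patch_eq hF, prevision_add_smul, h.zero H hH hne, mul_zero, add_zero]

/-- The retained generators restrict `F'` to the patches, `G'` selects the value `v`, and only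
membership in the credal set remains. -/
theorem IsBump.isExtremeDist_swap_iff (hB : IsMESC B) (h : IsBump B G s t ε) (hε : ε ≠ 0)
    (hB' : IsMESC (swap B G G')) (hF : IsExtremeDist lo up B F) {cond : Prop}
    (hG' : ∀ w, TightAt lo up (patch F s t w) G' ↔ w = v)
    (hcond : patch F s t v ∈ credalSet n lo up ↔ cond) :
    IsExtremeDist lo up (swap B G G') F' ↔ cond ∧ F' = patch F s t v := by
  rw [hB'.isExtremeDist_iff]
  constructor
  · rintro ⟨hF', hT⟩
    obtain ⟨w, rfl⟩ := (h.tightAt_iff hB hε hF hF').1 fun H hH hne =>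
      hT H (mem_swap_of_ne hH hne)
    obtain rfl := (hG' w).1 (hT _ mem_swap_self)
    exact ⟨hcond.1 hF', rfl⟩
  · rintro ⟨hc, rfl⟩
    have hF' := hcond.2 hc
    refine ⟨hF', fun H hH => ?_⟩
    rcases Finset.mem_insert.1 hH with rfl | hH
    · exact (hG' v).2 rfl
    · exact (h.tightAt_iff hB hε hF hF').2 ⟨v, rfl⟩ H (Finset.mem_of_mem_erase hH)
        (Finset.ne_of_mem_erase hH)

/-- Monotonicity can fail only at the two ends, and by monotonicity of the bounds only the last
lower and the first upper bound on the interval matter. -/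
theorem patch_mem_credalSet_iff (hp : IsPBox n lo up) (hF : F ∈ credalSet n lo up) (hs : 1 ≤ s)
    (hst : s ≤ t) (ht : t < n) :
    patch F s t v ∈ credalSet n lo up ↔ F (s - 1) ≤ v ∧ v ≤ F (t + 1) ∧ lo t ≤ v ∧ v ≤ up s := by
  obtain ⟨⟨hm, h0, h1⟩, hlo, hup⟩ := hF
  constructor
  · rintro ⟨⟨hm', -, -⟩, hlo', hup'⟩
    have e1 := hm' (show s - 1 ≤ s by omega)
    have e2 := hm' (show t ≤ t + 1 by omega)
    have e3 := hlo' t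
    have e4 := hup' s
    rw [patch_of_lt (by omega), patch_of_mem le_rfl hst] at e1
    rw [patch_of_gt (k := t + 1) (by omega), patch_of_mem hst le_rfl] at e2
    rw [patch_of_mem hst le_rfl] at e3
    rw [patch_of_mem le_rfl hst] at e4
    exact ⟨e1, e2, e3, e4⟩
  · rintro ⟨e1, e2, e3, e4⟩
    refine ⟨⟨fun k l hkl => ?_, ?_, fun k hk => ?_⟩, fun k => ?_, fun k => ?_⟩
    · simp only [patch]
      split_ifs with h2 h3 h3
      · exact le_rfl
      · exact e2.trans (hm (by omega))
      · exact (hm (by omega)).trans e1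
      · exact hm hkl
    · rw [patch_of_lt (by omega), h0]
    · rw [patch_of_gt (by omega), h1 k hk]
    · simp only [patch]
      split_ifs with h2
      · exact (hp.1.1 h2.2).trans e3
      · exact hlo k
    · simp only [patch]
      split_ifs with h2
      · exact e4.trans (hp.2.1.1 h2.1)
      · exact hup k

theorem IsBump.le_patch (h : IsBump B G s t ε) (hF : IsExtremeDist lo up B F) (hv : F s ≤ v) :
    F ≤ patch F s t v := by
  intro k
  simp only [patch]
  split_ifs with hk
  · rw [h.eq_start hF hk.1 hk.2]; exact hv
  · exact le_rfl

theorem IsBump.patch_le (h : IsBump B G s t ε) (hF : IsExtremeDist lo up B F) (hv : v ≤ F s) :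
    patch F s t v ≤ F := by
  intro k
  simp only [patch]
  split_ifs with hk
  · rw [h.eq_start hF hk.1 hk.2]; exact hv
  · exact le_rfl

variable {cond : Prop}

/-- The value `up s` meets its own upper bound and is at least `F s`; only monotonicity at the right
end is left. -/
theorem IsBump.yieldsAbove_compl (hB : IsMESC B) (h : IsBump B G s t ε) (hε : ε ≠ 0)
    (hadj : AdjacentSwap B G (seg n s)ᶜ) (hp : IsPBox n lo up) (hF : IsExtremeDist lo up B F)
    (hcond : up s ≤ F (t + 1) ↔ cond) :
    YieldsAbove lo up (swap B G (seg n s)ᶜ) F cond s t (up s) := by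
  have hs := h.one_le
  have hst := h.le
  have ht := h.lt
  obtain ⟨⟨hm, -, -⟩, hlo, hup⟩ := id hF.extreme.1
  have e1 := hup s
  have e2 := hlo t
  rw [h.eq_start hF hst le_rfl] at e2
  refine ⟨fun F' => h.isExtremeDist_swap_iff hB hε hadj.2.2.2.1 hF (fun w => ?_) ?_,
    fun _ => h.le_patch hF e1⟩
  · rw [tightAt_compl_iff hs (by omega), patch_of_mem le_rfl hst]
  · rw [patch_mem_credalSet_iff hp hF.extreme.1 hs hst ht, ← hcond]
    have e3 := hm (show s - 1 ≤ s by omega)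
    exact ⟨fun h => h.2.1, fun h => ⟨e3.trans e1, h, e2.trans e1, le_rfl⟩⟩

/-- The value is that of `F` just right of the bump, so only the upper bound is left. `htn` is
needed because $\{x_n\}$ carries the constraint of $A_{n-1}^c$ instead. -/
theorem IsBump.yieldsAbove_pt (hB : IsMESC B) (h : IsBump B G s t ε) (hε : ε ≠ 0)
    (htn : t + 1 < n) (hadj : AdjacentSwap B G (pt n (t + 1))) (hp : IsPBox n lo up)
    (hF : IsExtremeDist lo up B F) (hv : F (t + 1) = v) (hcond : v ≤ up s ↔ cond) :
    YieldsAbove lo up (swap B G (pt n (t + 1))) F cond s t v := by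
  have hs := h.one_le
  have hst := h.le
  have ht := h.lt
  obtain ⟨⟨hm, -, -⟩, hlo, hup⟩ := id hF.extreme.1
  have e1 := hm (show s ≤ t + 1 by omega)
  rw [hv] at e1
  have e2 := hlo t
  rw [h.eq_start hF hst le_rfl] at e2
  refine ⟨fun F' => h.isExtremeDist_swap_iff hB hε hadj.2.2.2.1 hF (fun w => ?_) ?_,
    fun _ => h.le_patch hF e1⟩
  · rw [tightAt_pt_iff (by omega) htn, patch_of_gt (by omega), Nat.add_sub_cancel,
      patch_of_mem hst le_rfl, hv, eq_comm]
  · rw [patch_mem_credalSet_iff hp hF.extreme.1 hs hst ht, ← hcond]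
    have e3 := hm (show s - 1 ≤ s by omega)
    exact ⟨fun h => h.2.2.2, fun h => ⟨e3.trans e1, hv.ge, e2.trans e1, h⟩⟩

theorem IsBump.yieldsBelow_seg (hB : IsMESC B) (h : IsBump B G s t ε) (hε : ε ≠ 0)
    (hadj : AdjacentSwap B G (seg n t)) (hp : IsPBox n lo up) (hF : IsExtremeDist lo up B F)
    (hcond : F (s - 1) ≤ lo t ↔ cond) :
    YieldsBelow lo up (swap B G (seg n t)) F cond s t (lo t) := by
  have hs := h.one_le
  have hst := h.le
  have ht := h.lt
  obtain ⟨⟨hm, -, -⟩, hlo, hup⟩ := id hF.extreme.1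
  have e1 := hup s
  have e2 := hlo t
  rw [h.eq_start hF hst le_rfl] at e2
  refine ⟨fun F' => h.isExtremeDist_swap_iff hB hε hadj.2.2.2.1 hF (fun w => ?_) ?_,
    fun _ => h.patch_le hF e2⟩
  · rw [tightAt_seg_iff (by omega) ht, patch_of_mem hst le_rfl]
  · rw [patch_mem_credalSet_iff hp hF.extreme.1 hs hst ht, ← hcond]
    have e3 := hm (show s ≤ t + 1 by omega)
    exact ⟨fun h => h.1, fun h => ⟨h, e2.trans e3, le_rfl, e2.trans e1⟩⟩

theorem IsBump.yieldsBelow_pt (hB : IsMESC B) (h : IsBump B G s t ε) (hε : ε ≠ 0)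
    (hs1 : 1 < s) (hadj : AdjacentSwap B G (pt n s)) (hp : IsPBox n lo up)
    (hF : IsExtremeDist lo up B F) (hv : F (s - 1) = v) (hcond : lo t ≤ v ↔ cond) :
    YieldsBelow lo up (swap B G (pt n s)) F cond s t v := by
  have hs := h.one_le
  have hst := h.le
  have ht := h.lt
  obtain ⟨⟨hm, -, -⟩, hlo, hup⟩ := id hF.extreme.1
  have e1 := hm (show s - 1 ≤ s by omega)
  rw [hv] at e1
  have e2 := hup s
  refine ⟨fun F' => h.isExtremeDist_swap_iff hB hε hadj.2.2.2.1 hF (fun w => ?_) ?_,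
    fun _ => h.patch_le hF e1⟩
  · rw [tightAt_pt_iff hs1 (by omega), patch_of_mem le_rfl hst, patch_of_lt (by omega), hv]
  · rw [patch_mem_credalSet_iff hp hF.extreme.1 hs hst ht, ← hcond]
    have e3 := hm (show s ≤ t + 1 by omega)
    exact ⟨fun h => h.2.2.1, fun h => ⟨hv.le, e1.trans e3, h, e1.trans e2⟩⟩

end

/-! ### The excludable generators and the shape of the pairs -/

theorem IsMESC.generator_cases (hB : IsMESC B) {G : Finset (Fin n)} (hG : G ∈ B)
    (hGu : G ≠ Finset.univ) :
    (∃ a b i, Consec B a b ∧ a < i ∧ i ≤ b ∧ Sing B i ∧ G = pt n i) ∨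
      ∃ a b c, Consec B a b ∧ Consec B b c ∧
        ((Pos B b ∧ G = seg n b) ∨ (Neg B b ∧ G = (seg n b)ᶜ)) := by
  rcases hB.mem_cases hG with ⟨k, h1, h2, hk, rfl⟩ | ⟨k, hk, rfl⟩ | ⟨i, hi, rfl⟩
  · have hkn : k < n := lt_of_le_of_ne h2 fun he => hGu (by rw [he, seg_self])
    obtain ⟨a, ha⟩ := hB.exists_consec_left (Or.inl hk) h1
    obtain ⟨c, hc⟩ := hB.exists_consec_right (Or.inl hk) hkn
    exact Or.inr ⟨a, k, c, ha, hc, Or.inl ⟨hk, rfl⟩⟩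
  · obtain ⟨a, ha⟩ := hB.exists_consec_left (Or.inr hk) hk.1
    obtain ⟨c, hc⟩ := hB.exists_consec_right (Or.inr hk) hk.2.1
    exact Or.inr ⟨a, k, c, ha, hc, Or.inr ⟨hk, rfl⟩⟩
  · obtain ⟨a, b, hab, h1, h2⟩ := hB.exists_consec hi.1.le hi.2.1.le
    exact Or.inl ⟨a, b, i, hab, h1, h2, hi, rfl⟩

theorem IsMESC.existsUnique_missing (hB : IsMESC B) {a b : ℕ} (h : Consec B a b) :
    ∃! j, Missing B a b j := by
  obtain ⟨j, hj⟩ := hB.exists_missing h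
  exact ⟨j, hj, fun j' hj' => hB.missing_unique h hj' hj⟩

/-- Both $a+1$ and $b$ are missing. -/
theorem IsMESC.eq_succ_of_pos_neg (hB : IsMESC B) {a b : ℕ} (h : Consec B a b) (ha : Pos B a)
    (hb : Neg B b) : b = a + 1 :=
  hB.missing_unique h (hB.missing_of_neg_right h hb) (hB.missing_of_pos_left h ha)

theorem IsMESC.missing_eq_of_right_eq_last (hB : IsMESC B) {a b j : ℕ} (h : Consec B a b)
    (hj : Missing B a b j) (hb : b = n) : j = n :=
  hB.missing_unique h hj ⟨hb ▸ h.lt, hb.ge, not_sing_last⟩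

section
variable {a b s t : ℕ} {G G' : Finset (Fin n)}

/-- An upward bump that ends in a pair whose right end is of sign `+`. -/
theorem IsBump.adjacentSwap_iff_up (hB : IsMESC B) (h : IsBump B G s t 1) (hab : Consec B a b)
    (hb : Pos B b) (hj : Missing B a b (t + 1)) :
    AdjacentSwap B G G' ↔ (b < n ∧ G' = pt n (t + 1)) ∨ G' = (seg n s)ᶜ := by
  rcases hab.le.eq_or_lt with hn | hn
  · rw [h.adjacentSwap_iff_of_neg_end hB (Or.inr (hB.missing_eq_of_right_eq_last hab hj hn))]
    exact ⟨Or.inr, fun h => h.resolve_left fun h' => h'.1.ne hn⟩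
  · rw [h.adjacentSwap_iff_of_pos_end hB hab hb hn hj]
    simp [hn]

end

end PBox

/-! ### Assembly of the cases -/

theorem mainTheorem5 {n : ℕ} (B : Finset (Finset (Fin n))) (hB : PBox.IsMESC B) :
    -- Every adjacent cone arises by replacing one generator other than the whole space.
    (∀ B' : Finset (Finset (Fin n)), PBox.IsMESC B' →
      (PBox.ConesAdjacent (PBox.cone B) (PBox.cone B') ↔
        ∃ G G', PBox.AdjacentSwap B G G' ∧ B' = PBox.swap B G G')) ∧
    -- The replaced generator is a singleton inside a pair, or the middle set of a triple.
    (∀ G ∈ B, G ≠ Finset.univ →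
      (∃ a b i, PBox.Consec B a b ∧ a < i ∧ i ≤ b ∧ PBox.Sing B i ∧ G = PBox.pt n i) ∨
      (∃ a b c, PBox.Consec B a b ∧ PBox.Consec B b c ∧
        ((PBox.Pos B b ∧ G = PBox.seg n b) ∨ (PBox.Neg B b ∧ G = (PBox.seg n b)ᶜ)))) ∧
    -- In every pair exactly one singleton is missing; its position in the four cases.
    (∀ a b, PBox.Consec B a b →
      (∃! j, PBox.Missing B a b j) ∧
      (PBox.Pos B a → PBox.Pos B b → PBox.Missing B a b (a + 1)) ∧
      (PBox.Pos B a → PBox.Neg B b → b = a + 1) ∧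
      (PBox.Neg B a → PBox.Neg B b → PBox.Missing B a b b)) ∧
    -- Case 1A
    (∀ a b i, PBox.Consec B a b → PBox.Pos B a → PBox.Pos B b → a < i → i ≤ b → PBox.Sing B i →
      (∀ G', PBox.AdjacentSwap B (PBox.pt n i) G' ↔ G' = PBox.seg n (i - 1)) ∧
      ∀ lo up F, PBox.IsPBox n lo up → PBox.IsExtremeDist lo up B F →
        PBox.YieldsBelow lo up (PBox.swap B (PBox.pt n i) (PBox.seg n (i - 1))) F
          True (a + 1) (i - 1) (lo (i - 1))) ∧
    -- Case 2A
    (∀ a b, PBox.Consec B a b → PBox.Pos B a → PBox.Neg B b →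
      ∀ i, a < i → i ≤ b → ¬ PBox.Sing B i) ∧
    -- Case 3A, `i < j`
    (∀ a b i j, PBox.Consec B a b → PBox.Neg B a → PBox.Pos B b → PBox.Missing B a b j →
      a < i → i < j → PBox.Sing B i →
      (∀ G', PBox.AdjacentSwap B (PBox.pt n i) G' ↔
        (b < n ∧ G' = PBox.pt n j) ∨ G' = (PBox.seg n i)ᶜ) ∧
      ∀ lo up F, PBox.IsPBox n lo up → PBox.IsExtremeDist lo up B F →
        (∀ k, a ≤ k → k ≤ b → F k = if k ≤ j - 1 then up a else lo b) ∧
        (b < n → PBox.YieldsAbove lo up (PBox.swap B (PBox.pt n i) (PBox.pt n j)) F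
          (lo b ≤ up i) i (j - 1) (lo b)) ∧
        PBox.YieldsAbove lo up (PBox.swap B (PBox.pt n i) (PBox.seg n i)ᶜ) F
          (up i ≤ lo b) i (j - 1) (up i)) ∧
    -- Case 3A, `i > j`
    (∀ a b i j, PBox.Consec B a b → PBox.Neg B a → PBox.Pos B b → PBox.Missing B a b j →
      j < i → i ≤ b → PBox.Sing B i →
      (∀ G', PBox.AdjacentSwap B (PBox.pt n i) G' ↔
        G' = PBox.pt n j ∨ G' = PBox.seg n (i - 1)) ∧
      ∀ lo up F, PBox.IsPBox n lo up → PBox.IsExtremeDist lo up B F →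
        (∀ k, a ≤ k → k ≤ b → F k = if k ≤ j - 1 then up a else lo b) ∧
        PBox.YieldsBelow lo up (PBox.swap B (PBox.pt n i) (PBox.pt n j)) F
          (lo (i - 1) ≤ up a) j (i - 1) (up a) ∧
        PBox.YieldsBelow lo up (PBox.swap B (PBox.pt n i) (PBox.seg n (i - 1))) F
          (up a ≤ lo (i - 1)) j (i - 1) (lo (i - 1))) ∧
    -- Case 4A
    (∀ a b i, PBox.Consec B a b → PBox.Neg B a → PBox.Neg B b → a < i → i ≤ b → PBox.Sing B i →
      (∀ G', PBox.AdjacentSwap B (PBox.pt n i) G' ↔ G' = (PBox.seg n i)ᶜ) ∧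
      ∀ lo up F, PBox.IsPBox n lo up → PBox.IsExtremeDist lo up B F →
        PBox.YieldsAbove lo up (PBox.swap B (PBox.pt n i) (PBox.seg n i)ᶜ) F
          True i (b - 1) (up i)) ∧
    -- Case 1B, first variant
    (∀ a b c, PBox.Consec B a b → PBox.Consec B b c →
      PBox.Pos B a → PBox.Pos B b → PBox.Pos B c →
      (∀ G', PBox.AdjacentSwap B (PBox.seg n b) G' ↔
        (c < n ∧ G' = PBox.pt n (b + 1)) ∨ G' = (PBox.seg n (a + 1))ᶜ) ∧
      ∀ lo up F, PBox.IsPBox n lo up → PBox.IsExtremeDist lo up B F →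
        (∀ k, a ≤ k → k ≤ c →
          F k = if k = a then lo a else if k ≤ b then lo b else lo c) ∧
        (c < n → PBox.YieldsAbove lo up (PBox.swap B (PBox.seg n b) (PBox.pt n (b + 1))) F
          (lo c ≤ up (a + 1)) (a + 1) b (lo c)) ∧
        PBox.YieldsAbove lo up (PBox.swap B (PBox.seg n b) (PBox.seg n (a + 1))ᶜ) F
          (up (a + 1) ≤ lo c) (a + 1) b (up (a + 1))) ∧
    -- Case 1B, second variant
    (∀ a b c j, PBox.Consec B a b → PBox.Consec B b c →
      PBox.Pos B a → PBox.Neg B b → PBox.Pos B c → PBox.Missing B b c j →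
      (∀ G', PBox.AdjacentSwap B (PBox.seg n b)ᶜ G' ↔ G' = PBox.seg n (j - 1)) ∧
      ∀ lo up F, PBox.IsPBox n lo up → PBox.IsExtremeDist lo up B F →
        (∀ k, a ≤ k → k ≤ c →
          F k = if k = a then lo a else if k ≤ j - 1 then up (a + 1) else lo c) ∧
        PBox.YieldsBelow lo up (PBox.swap B (PBox.seg n b)ᶜ (PBox.seg n (j - 1))) F
          True (a + 1) (j - 1) (lo (j - 1))) ∧
    -- Case 2B, first variant
    (∀ a b c, PBox.Consec B a b → PBox.Consec B b c →
      PBox.Pos B a → PBox.Pos B b → PBox.Neg B c →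
      c = b + 1 ∧
      (∀ G', PBox.AdjacentSwap B (PBox.seg n b) G' ↔ G' = (PBox.seg n (a + 1))ᶜ) ∧
      ∀ lo up F, PBox.IsPBox n lo up → PBox.IsExtremeDist lo up B F →
        (∀ k, a ≤ k → k ≤ c →
          F k = if k = a then lo a else if k ≤ b then lo b else up c) ∧
        PBox.YieldsAbove lo up (PBox.swap B (PBox.seg n b) (PBox.seg n (a + 1))ᶜ) F
          True (a + 1) b (up (a + 1))) ∧
    -- Case 2B, second variant
    (∀ a b c, PBox.Consec B a b → PBox.Consec B b c →
      PBox.Pos B a → PBox.Neg B b → PBox.Neg B c →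
      b = a + 1 ∧
      (∀ G', PBox.AdjacentSwap B (PBox.seg n b)ᶜ G' ↔ G' = PBox.seg n (c - 1)) ∧
      ∀ lo up F, PBox.IsPBox n lo up → PBox.IsExtremeDist lo up B F →
        (∀ k, a ≤ k → k ≤ c →
          F k = if k = a then lo a else if k ≤ c - 1 then up (a + 1) else up c) ∧
        PBox.YieldsBelow lo up (PBox.swap B (PBox.seg n b)ᶜ (PBox.seg n (c - 1))) F
          True (a + 1) (c - 1) (lo (c - 1))) ∧
    -- Case 3B, first variant
    (∀ a b c j, PBox.Consec B a b → PBox.Consec B b c →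
      PBox.Neg B a → PBox.Pos B b → PBox.Pos B c → PBox.Missing B a b j →
      (∀ G', PBox.AdjacentSwap B (PBox.seg n b) G' ↔
        (c < n ∧ G' = PBox.pt n (b + 1)) ∨ G' = (PBox.seg n j)ᶜ) ∧
      ∀ lo up F, PBox.IsPBox n lo up → PBox.IsExtremeDist lo up B F →
        (∀ k, a ≤ k → k ≤ c →
          F k = if k ≤ j - 1 then up a else if k ≤ b then lo b else lo c) ∧
        (c < n → PBox.YieldsAbove lo up (PBox.swap B (PBox.seg n b) (PBox.pt n (b + 1))) F
          (lo c ≤ up j) j b (lo c)) ∧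
        PBox.YieldsAbove lo up (PBox.swap B (PBox.seg n b) (PBox.seg n j)ᶜ) F
          (up j ≤ lo c) j b (up j)) ∧
    -- Case 3B, second variant
    (∀ a b c j, PBox.Consec B a b → PBox.Consec B b c →
      PBox.Neg B a → PBox.Neg B b → PBox.Pos B c → PBox.Missing B b c j →
      (∀ G', PBox.AdjacentSwap B (PBox.seg n b)ᶜ G' ↔
        G' = PBox.seg n (j - 1) ∨ G' = PBox.pt n b) ∧
      ∀ lo up F, PBox.IsPBox n lo up → PBox.IsExtremeDist lo up B F →
        (∀ k, a ≤ k → k ≤ c →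
          F k = if k ≤ b - 1 then up a else if k ≤ j - 1 then up b else lo c) ∧
        PBox.YieldsBelow lo up (PBox.swap B (PBox.seg n b)ᶜ (PBox.seg n (j - 1))) F
          (up a ≤ lo (j - 1)) b (j - 1) (lo (j - 1)) ∧
        PBox.YieldsBelow lo up (PBox.swap B (PBox.seg n b)ᶜ (PBox.pt n b)) F
          (lo (j - 1) ≤ up a) b (j - 1) (up a)) ∧
    -- Case 4B, first variant
    (∀ a b c j, PBox.Consec B a b → PBox.Consec B b c →
      PBox.Neg B a → PBox.Pos B b → PBox.Neg B c → PBox.Missing B a b j →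
      c = b + 1 ∧
      (∀ G', PBox.AdjacentSwap B (PBox.seg n b) G' ↔ G' = (PBox.seg n j)ᶜ) ∧
      ∀ lo up F, PBox.IsPBox n lo up → PBox.IsExtremeDist lo up B F →
        (∀ k, a ≤ k → k ≤ c →
          F k = if k ≤ j - 1 then up a else if k ≤ b then lo b else up c) ∧
        PBox.YieldsAbove lo up (PBox.swap B (PBox.seg n b) (PBox.seg n j)ᶜ) F
          True j b (up j)) ∧
    -- Case 4B, second variant
    (∀ a b c, PBox.Consec B a b → PBox.Consec B b c →
      PBox.Neg B a → PBox.Neg B b → PBox.Neg B c →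
      (∀ G', PBox.AdjacentSwap B (PBox.seg n b)ᶜ G' ↔
        G' = PBox.seg n (c - 1) ∨ G' = PBox.pt n b) ∧
      ∀ lo up F, PBox.IsPBox n lo up → PBox.IsExtremeDist lo up B F →
        (∀ k, a ≤ k → k ≤ c →
          F k = if k ≤ b - 1 then up a else if k ≤ c - 1 then up b else up c) ∧
        PBox.YieldsBelow lo up (PBox.swap B (PBox.seg n b)ᶜ (PBox.seg n (c - 1))) F
          (up a ≤ lo (c - 1)) b (c - 1) (lo (c - 1)) ∧
        PBox.YieldsBelow lo up (PBox.swap B (PBox.seg n b)ᶜ (PBox.pt n b)) F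
          (lo (c - 1) ≤ up a) b (c - 1) (up a)) := by
  refine ⟨fun B' hB' => ⟨hB.exists_swap_of_conesAdjacent hB', ?_⟩,
    fun G hG hGu => hB.generator_cases hG hGu, fun a b hab => ⟨hB.existsUnique_missing hab,
      fun ha _ => hB.missing_of_pos_left hab ha, hB.eq_succ_of_pos_neg hab,
      fun _ hb => hB.missing_of_neg_right hab hb⟩, ?_, ?_, ?_, ?_, ?_, ?_, ?_, ?_, ?_, ?_, ?_, ?_, ?_⟩
  · rintro ⟨G, G', h, rfl⟩
    exact h.2.2.2.2
  · intro a b i hab ha hb hai hib hi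
    have hj := hB.missing_of_pos_left hab ha
    have hji : a + 1 < i := lt_of_le_of_ne hai fun he => hj.2.2 (he ▸ hi)
    have hbump := hB.isBump_pt_of_gt hab hj hji hib hi
    have hadj : ∀ G', PBox.AdjacentSwap B (PBox.pt n i) G' ↔ G' = PBox.seg n (i - 1) :=
      fun G' => hbump.adjacentSwap_iff_of_pos_start hB ha
    refine ⟨hadj, fun lo up F hp hF => ?_⟩
    refine hbump.yieldsBelow_seg hB (by norm_num) ((hadj _).2 rfl) hp hF (iff_true_intro ?_)
    -- The condition is automatic: `F` takes the value `lo a` just before the bump, and `lo` is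
    -- increasing.
    rw [Nat.add_sub_cancel, hF.eq_lo hp ha]
    exact hp.1.1 (by omega)
  · intro a b hab ha hb i hai hib hi
    have := hB.eq_succ_of_pos_neg hab ha hb
    have hj := hB.missing_of_neg_right hab hb
    exact hj.2.2 ((show i = b by omega) ▸ hi)
  · intro a b i j hab ha hb hj hai hij hi
    have hjb := hj.2.1
    have hbn := hab.le
    have hbump := hB.isBump_pt_of_lt hab hj hai hij hi
    have e : j - 1 + 1 = j := by omega
    have hadj : ∀ G', PBox.AdjacentSwap B (PBox.pt n i) G' ↔
        (b < n ∧ G' = PBox.pt n j) ∨ G' = (PBox.seg n i)ᶜ := fun G' => by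
      have := hbump.adjacentSwap_iff_up (G' := G') hB hab hb (e.symm ▸ hj)
      rwa [e] at this
    refine ⟨hadj, fun lo up F hp hF => ?_⟩
    have hFj : F j = lo b := by
      rw [hF.eq_right hB hab hj le_rfl hjb, hF.eq_lo hp hb]
    refine ⟨fun k hak hkb => ?_, fun hbn => ?_, ?_⟩
    · split_ifs with hk
      · rw [hF.eq_left hB hab hj hak (by omega), hF.eq_up ha]
      · rw [hF.eq_right hB hab hj (by omega) hkb, hF.eq_lo hp hb]
    · have := hbump.yieldsAbove_pt (v := lo b) hB one_ne_zero (by omega)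
        (by rw [e]; exact (hadj _).2 (Or.inl ⟨hbn, rfl⟩)) hp hF (by rw [e, hFj]) Iff.rfl
      rwa [e] at this
    · refine hbump.yieldsAbove_compl hB one_ne_zero ((hadj _).2 (Or.inr rfl)) hp hF ?_
      rw [e, hFj]
  · intro a b i j hab ha hb hj hji hib hi
    have haj := hj.1
    have ha1 := ha.1
    have hbump := hB.isBump_pt_of_gt hab hj hji hib hi
    have hadj : ∀ G', PBox.AdjacentSwap B (PBox.pt n i) G' ↔
        G' = PBox.pt n j ∨ G' = PBox.seg n (i - 1) := fun G' => by
      rw [hbump.adjacentSwap_iff_of_neg_start hB hab ha hj, or_comm]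
    refine ⟨hadj, fun lo up F hp hF => ?_⟩
    have hFj : F (j - 1) = up a := by
      rw [hF.eq_left hB hab hj (by omega) (by omega), hF.eq_up ha]
    refine ⟨fun k hak hkb => ?_, ?_, ?_⟩
    · split_ifs with hk
      · rw [hF.eq_left hB hab hj hak (by omega), hF.eq_up ha]
      · rw [hF.eq_right hB hab hj (by omega) hkb, hF.eq_lo hp hb]
    · exact hbump.yieldsBelow_pt hB (by norm_num) (by omega) ((hadj _).2 (Or.inl rfl)) hp hF hFj
        Iff.rfl
    · refine hbump.yieldsBelow_seg hB (by norm_num) ((hadj _).2 (Or.inr rfl)) hp hF ?_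
      rw [hFj]
  · intro a b i hab ha hb hai hib hi
    have hj := hB.missing_of_neg_right hab hb
    have hij : i < b := lt_of_le_of_ne hib fun he => hj.2.2 (he ▸ hi)
    have hbump := hB.isBump_pt_of_lt hab hj hai hij hi
    have e : b - 1 + 1 = b := by omega
    have hadj : ∀ G', PBox.AdjacentSwap B (PBox.pt n i) G' ↔ G' = (PBox.seg n i)ᶜ :=
      fun G' => hbump.adjacentSwap_iff_of_neg_end hB (Or.inl (e.symm ▸ hb))
    refine ⟨hadj, fun lo up F hp hF => ?_⟩
    refine hbump.yieldsAbove_compl hB one_ne_zero ((hadj _).2 rfl) hp hF (iff_true_intro ?_)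
    -- Automatic again: just after the bump `F` takes the value `up b`, and `up` is increasing.
    rw [e, hF.eq_up hb]
    exact hp.2.1.1 hib
  · intro a b c hab hbc ha hb hc
    have hj := hB.missing_of_pos_left hab ha
    have hj' := hB.missing_of_pos_left hbc hb
    have hlt := hab.lt
    have hlt' := hbc.lt
    have hbump := hB.isBump_seg hab hbc hb hj hj'
    -- Since `b` has sign $+$, the next missing index is $b+1$ and the bump ends at `b`.
    rw [Nat.add_sub_cancel] at hbump
    have hadj : ∀ G', PBox.AdjacentSwap B (PBox.seg n b) G' ↔
        (c < n ∧ G' = PBox.pt n (b + 1)) ∨ G' = (PBox.seg n (a + 1))ᶜ :=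
      fun G' => hbump.adjacentSwap_iff_up hB hbc hc hj'
    refine ⟨hadj, fun lo up F hp hF => ?_⟩
    have hFb : F (b + 1) = lo c := by
      rw [hF.eq_right hB hbc hj' le_rfl hlt', hF.eq_lo hp hc]
    refine ⟨fun k hak hkc => ?_, fun hcn => ?_, ?_⟩
    · split_ifs with h1 h2
      · rw [h1, hF.eq_lo hp ha]
      · rw [hF.eq_right hB hab hj (by omega) h2, hF.eq_lo hp hb]
      · rw [hF.eq_right hB hbc hj' (by omega) hkc, hF.eq_lo hp hc]
    · exact hbump.yieldsAbove_pt hB one_ne_zero (by omega) ((hadj _).2 (Or.inl ⟨hcn, rfl⟩)) hp hF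
        hFb Iff.rfl
    · refine hbump.yieldsAbove_compl hB one_ne_zero ((hadj _).2 (Or.inr rfl)) hp hF ?_
      rw [hFb]
  · intro a b c j hab hbc ha hb hc hj'
    have hj := hB.missing_of_neg_right hab hb
    obtain rfl := hB.eq_succ_of_pos_neg hab ha hb
    have hbj := hj'.1
    have hbump := hB.isBump_compl hab hbc hb hj hj'
    have hadj : ∀ G', PBox.AdjacentSwap B (PBox.seg n (a + 1))ᶜ G' ↔ G' = PBox.seg n (j - 1) :=
      fun G' => hbump.adjacentSwap_iff_of_pos_start hB ha
    refine ⟨hadj, fun lo up F hp hF => ⟨fun k hak hkc => ?_, ?_⟩⟩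
    · split_ifs with h1 h2
      · rw [h1, hF.eq_lo hp ha]
      · rw [hF.eq_left hB hbc hj' (by omega) (by omega), hF.eq_up hb]
      · rw [hF.eq_right hB hbc hj' (by omega) hkc, hF.eq_lo hp hc]
    · refine hbump.yieldsBelow_seg hB (by norm_num) ((hadj _).2 rfl) hp hF (iff_true_intro ?_)
      rw [Nat.add_sub_cancel, hF.eq_lo hp ha]
      exact hp.1.1 (by omega)
  · intro a b c hab hbc ha hb hc
    have hj := hB.missing_of_pos_left hab ha
    have hj' := hB.missing_of_pos_left hbc hb
    have hlt := hab.lt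
    obtain rfl := hB.eq_succ_of_pos_neg hbc hb hc
    have hbump := hB.isBump_seg hab hbc hb hj hj'
    rw [Nat.add_sub_cancel] at hbump
    have hadj : ∀ G', PBox.AdjacentSwap B (PBox.seg n b) G' ↔ G' = (PBox.seg n (a + 1))ᶜ :=
      fun G' => hbump.adjacentSwap_iff_of_neg_end hB (Or.inl hc)
    refine ⟨rfl, hadj, fun lo up F hp hF => ⟨fun k hak hkc => ?_, ?_⟩⟩
    · split_ifs with h1 h2
      · rw [h1, hF.eq_lo hp ha]
      · rw [hF.eq_right hB hab hj (by omega) h2, hF.eq_lo hp hb]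
      · rw [show k = b + 1 by omega, hF.eq_up hc]
    · refine hbump.yieldsAbove_compl hB one_ne_zero ((hadj _).2 rfl) hp hF (iff_true_intro ?_)
      rw [hF.eq_up hc]
      exact hp.2.1.1 (by omega)
  · intro a b c hab hbc ha hb hc
    have hj := hB.missing_of_neg_right hab hb
    have hj' := hB.missing_of_neg_right hbc hc
    have hlt := hbc.lt
    obtain rfl := hB.eq_succ_of_pos_neg hab ha hb
    have hbump := hB.isBump_compl hab hbc hb hj hj'
    have hadj : ∀ G', PBox.AdjacentSwap B (PBox.seg n (a + 1))ᶜ G' ↔ G' = PBox.seg n (c - 1) :=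
      fun G' => hbump.adjacentSwap_iff_of_pos_start hB ha
    refine ⟨rfl, hadj, fun lo up F hp hF => ⟨fun k hak hkc => ?_, ?_⟩⟩
    · split_ifs with h1 h2
      · rw [h1, hF.eq_lo hp ha]
      · rw [hF.eq_left hB hbc hj' (by omega) (by omega), hF.eq_up hb]
      · rw [show k = c by omega, hF.eq_up hc]
    · refine hbump.yieldsBelow_seg hB (by norm_num) ((hadj _).2 rfl) hp hF (iff_true_intro ?_)
      rw [Nat.add_sub_cancel, hF.eq_lo hp ha]
      exact hp.1.1 (by omega)
  · intro a b c j hab hbc ha hb hc hj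
    have hj' := hB.missing_of_pos_left hbc hb
    have haj := hj.1
    have hjb := hj.2.1
    have hlt' := hbc.lt
    have hbump := hB.isBump_seg hab hbc hb hj hj'
    rw [Nat.add_sub_cancel] at hbump
    have hadj : ∀ G', PBox.AdjacentSwap B (PBox.seg n b) G' ↔
        (c < n ∧ G' = PBox.pt n (b + 1)) ∨ G' = (PBox.seg n j)ᶜ :=
      fun G' => hbump.adjacentSwap_iff_up hB hbc hc hj'
    refine ⟨hadj, fun lo up F hp hF => ?_⟩
    have hFb : F (b + 1) = lo c := by
      rw [hF.eq_right hB hbc hj' le_rfl hlt', hF.eq_lo hp hc]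
    refine ⟨fun k hak hkc => ?_, fun hcn => ?_, ?_⟩
    · split_ifs with h1 h2
      · rw [hF.eq_left hB hab hj hak (by omega), hF.eq_up ha]
      · rw [hF.eq_right hB hab hj (by omega) h2, hF.eq_lo hp hb]
      · rw [hF.eq_right hB hbc hj' (by omega) hkc, hF.eq_lo hp hc]
    · exact hbump.yieldsAbove_pt hB one_ne_zero (by omega) ((hadj _).2 (Or.inl ⟨hcn, rfl⟩)) hp hF
        hFb Iff.rfl
    · refine hbump.yieldsAbove_compl hB one_ne_zero ((hadj _).2 (Or.inr rfl)) hp hF ?_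
      rw [hFb]
  · intro a b c j hab hbc ha hb hc hj'
    have hj := hB.missing_of_neg_right hab hb
    have hbj := hj'.1
    have ha1 := ha.1
    have hlt := hab.lt
    have hbump := hB.isBump_compl hab hbc hb hj hj'
    have hadj : ∀ G', PBox.AdjacentSwap B (PBox.seg n b)ᶜ G' ↔
        G' = PBox.seg n (j - 1) ∨ G' = PBox.pt n b :=
      fun G' => hbump.adjacentSwap_iff_of_neg_start hB hab ha hj
    refine ⟨hadj, fun lo up F hp hF => ?_⟩
    have hFb : F (b - 1) = up a := by
      rw [hF.eq_left hB hab hj (by omega) (by omega), hF.eq_up ha]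
    refine ⟨fun k hak hkc => ?_, ?_, ?_⟩
    · split_ifs with h1 h2
      · rw [hF.eq_left hB hab hj hak (by omega), hF.eq_up ha]
      · rw [hF.eq_left hB hbc hj' (by omega) (by omega), hF.eq_up hb]
      · rw [hF.eq_right hB hbc hj' (by omega) hkc, hF.eq_lo hp hc]
    · refine hbump.yieldsBelow_seg hB (by norm_num) ((hadj _).2 (Or.inl rfl)) hp hF ?_
      rw [hFb]
    · exact hbump.yieldsBelow_pt hB (by norm_num) (by omega) ((hadj _).2 (Or.inr rfl)) hp hF hFb
        Iff.rfl
  · intro a b c j hab hbc ha hb hc hj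
    have hj' := hB.missing_of_pos_left hbc hb
    have haj := hj.1
    have hjb := hj.2.1
    obtain rfl := hB.eq_succ_of_pos_neg hbc hb hc
    have hbump := hB.isBump_seg hab hbc hb hj hj'
    rw [Nat.add_sub_cancel] at hbump
    have hadj : ∀ G', PBox.AdjacentSwap B (PBox.seg n b) G' ↔ G' = (PBox.seg n j)ᶜ :=
      fun G' => hbump.adjacentSwap_iff_of_neg_end hB (Or.inl hc)
    refine ⟨rfl, hadj, fun lo up F hp hF => ⟨fun k hak hkc => ?_, ?_⟩⟩
    · split_ifs with h1 h2
      · rw [hF.eq_left hB hab hj hak (by omega), hF.eq_up ha]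
      · rw [hF.eq_right hB hab hj (by omega) h2, hF.eq_lo hp hb]
      · rw [show k = b + 1 by omega, hF.eq_up hc]
    · refine hbump.yieldsAbove_compl hB one_ne_zero ((hadj _).2 rfl) hp hF (iff_true_intro ?_)
      rw [hF.eq_up hc]
      exact hp.2.1.1 (by omega)
  · intro a b c hab hbc ha hb hc
    have hj := hB.missing_of_neg_right hab hb
    have hj' := hB.missing_of_neg_right hbc hc
    have ha1 := ha.1
    have hlt := hab.lt
    have hlt' := hbc.lt
    have hbump := hB.isBump_compl hab hbc hb hj hj'
    have hadj : ∀ G', PBox.AdjacentSwap B (PBox.seg n b)ᶜ G' ↔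
        G' = PBox.seg n (c - 1) ∨ G' = PBox.pt n b :=
      fun G' => hbump.adjacentSwap_iff_of_neg_start hB hab ha hj
    refine ⟨hadj, fun lo up F hp hF => ?_⟩
    have hFb : F (b - 1) = up a := by
      rw [hF.eq_left hB hab hj (by omega) (by omega), hF.eq_up ha]
    refine ⟨fun k hak hkc => ?_, ?_, ?_⟩
    · split_ifs with h1 h2
      · rw [hF.eq_left hB hab hj hak (by omega), hF.eq_up ha]
      · rw [hF.eq_left hB hbc hj' (by omega) (by omega), hF.eq_up hb]
      · rw [show k = c by omega, hF.eq_up hc]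
    · refine hbump.yieldsBelow_seg hB (by norm_num) ((hadj _).2 (Or.inl rfl)) hp hF ?_
      rw [hFb]
    · exact hbump.yieldsBelow_pt hB (by norm_num) (by omega) ((hadj _).2 (Or.inr rfl)) hp hF hFb
        Iff.rfl
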